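/- Let $\mu_0, M_0, f > 0$. Let $\mathbb{H}$ be the quaternions and $\mathbb{IH}\cong\mathbb{R}^3$ the purely imaginary quaternions. For the spatial Kepler problem $$T(P,Q)=\frac{|P|^2}{2\mu_0}-\frac{\mu_0M_0}{|Q|},\qquad Q\in\mathbb{IH}\setminus\{0\},\ P\in\mathbb{IH},$$ let $S_f=\{(Q,P) : T(P,Q)+f=0\}$ be the surface of energy $-f$. The Kustaanheimo–Stiefel (KS) mapping is $$K.S.(z,w)=\Bigl(Q=\bar z\, i\, z,\ P=\frac{\bar z\, i\, w}{2|z|^2}\Bigr),\qquad (z,w)\in\mathbb{H}\times\mathbb{H},\ z\neq 0 .$$ Put $K(z,w)=\frac{1}{8\mu_0}|w|^2+f|z|^2-\mu_0M_0$ and $\Sigma=\{(z,w)\in\mathbb{H}\times\mathbb{H} : \mathrm{Re}(\bar z\, i\, w)=0\}$, and let the circle act on $N_f=K^{-1}(0)\cap\Sigma$ by $\vartheta\cdot(z,w)=(e^{i\vartheta}z,e^{i\vartheta}w)$. Then $N_f$ and $S_f$ are smooth embedded submanifolds of $\mathbb{H}\times\mathbb{H}$ of dimensions $6$ and $5$,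 and the quotient $N_f/S^1$ is a smooth $5$-manifold such that the projection $N_f\to N_f/S^1$ is a smooth submersion. The quotient $N_f/S^1$ is the compactification of the energy surface $S_f$ determined by $K.S.$: it is compact and Hausdorff, and $K.S.$ induces a diffeomorphism from the dense open subset of the orbits with $z\neq0$ onto $S_f$. Moreover, $N_f/S^1$ is diffeomorphic to $\mathbb{S}^2\times\mathbb{S}^3$. -/

import Mathlib

open scoped Quaternion Manifold ContDiff

noncomputable section

namespace KS

/-- The quaternion unit `i`. -/
def qi : ℍ := ⟨0, 1, 0, 0⟩

/-- The Hamiltonian of the spatial Kepler problem with mass parameters `μ`, `M`, at the position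
`Q` and the momentum `P`, for a point `(Q, P)`. -/
def keplerHamiltonian (μ M : ℝ) (x : ℍ × ℍ) : ℝ :=
  ‖x.2‖ ^ 2 / (2 * μ) - μ * M / ‖x.1‖

/-- The Kepler energy surface `T = -f` in the cotangent bundle of the purely imaginary quaternions
(identified with `ℝ³`) without the origin; its points are the pairs `(Q, P)`. -/
def energySurface (μ M f : ℝ) : Set (ℍ × ℍ) :=
  {x | x.1.re = 0 ∧ x.2.re = 0 ∧ x.1 ≠ 0 ∧ keplerHamiltonian μ M x + f = 0}

/-- The bilinear relation `Re (z̄ i w)`. -/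
def BL (x : ℍ × ℍ) : ℝ := (star x.1 * qi * x.2).re

/-- The quadratic cone `Σ`, the zero set of the bilinear relation. -/
def cone : Set (ℍ × ℍ) := {x | BL x = 0}

/-- The Kustaanheimo-Stiefel mapping `(z, w) ↦ (Q, P) = (z̄ i z, z̄ i w / (2 |z|²))`, used for
`z ≠ 0` only. -/
def ksMap (x : ℍ × ℍ) : ℍ × ℍ :=
  (star x.1 * qi * x.1, (2 * ‖x.1‖ ^ 2)⁻¹ • (star x.1 * qi * x.2))

/-- The regularized Hamiltonian `K(z, w) = |w|² / (8 μ) + f |z|² - μ M`. -/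
def regularizedHamiltonian (μ M f : ℝ) (x : ℍ × ℍ) : ℝ :=
  ‖x.2‖ ^ 2 / (8 * μ) + f * ‖x.1‖ ^ 2 - μ * M

/-- The intersection of the zero level of `K` with the cone `Σ`. -/
def regularizedLevel (μ M f : ℝ) : Set (ℍ × ℍ) :=
  {x | regularizedHamiltonian μ M f x = 0} ∩ cone

theorem norm_circle (c : Circle) : ‖((c : ℂ) : ℍ)‖ = 1 := by
  have h : ‖((c : ℂ) : ℍ)‖ * ‖((c : ℂ) : ℍ)‖ = 1 := by
    rw [← Quaternion.normSq_eq_norm_mul_self, Quaternion.normSq_def']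
    have := Circle.normSq_coe c
    rw [Complex.normSq_apply] at this
    simp only [Quaternion.re_coeComplex, Quaternion.imI_coeComplex, Quaternion.imJ_coeComplex,
      Quaternion.imK_coeComplex]
    linarith
  nlinarith [norm_nonneg ((c : ℂ) : ℍ)]

theorem BL_circle (c : Circle) (x : ℍ × ℍ) :
    BL (((c : ℂ) : ℍ) * x.1, ((c : ℂ) : ℍ) * x.2) = BL x := by
  have := Circle.normSq_coe c
  rw [Complex.normSq_apply] at this
  have h0 : qi.re = 0 := rfl
  have h1 : qi.imI = 1 := rfl
  have h2 : qi.imJ = 0 := rfl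
  have h3 : qi.imK = 0 := rfl
  simp only [BL, h0, h1, h2, h3, Quaternion.re_mul, Quaternion.imI_mul, Quaternion.imJ_mul, Quaternion.imK_mul,
    Quaternion.re_star, Quaternion.imI_star, Quaternion.imJ_star, Quaternion.imK_star,
    Quaternion.re_coeComplex, Quaternion.imI_coeComplex, Quaternion.imJ_coeComplex,
    Quaternion.imK_coeComplex]
  linear_combination (-x.1.re * x.2.imI + x.1.imI * x.2.re - x.1.imJ * x.2.imK
    + x.1.imK * x.2.imJ) * this

/-- The circle action `(z, w) ↦ (e^{iϑ} z, e^{iϑ} w)`. -/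
instance circleAction (μ M f : ℝ) : MulAction Circle (regularizedLevel μ M f) where
  smul c x := ⟨(((c : ℂ) : ℍ) * x.1.1, ((c : ℂ) : ℍ) * x.1.2), by
    refine ⟨?_, ?_⟩
    · have h : regularizedHamiltonian μ M f x.1 = 0 := x.2.1
      simpa [regularizedHamiltonian, norm_circle] using h
    · have h : BL x.1 = 0 := x.2.2
      exact (BL_circle c x.1).trans h⟩
  one_smul x := Subtype.ext (Prod.ext (by change ((1 : ℂ) : ℍ) * _ = _; simp)
    (by change ((1 : ℂ) : ℍ) * _ = _; simp))
  mul_smul c d x := Subtype.ext (Prod.ext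
    (by change (((c : ℂ) * (d : ℂ) : ℂ) : ℍ) * _ = _ * (_ * _); simp [mul_assoc])
    (by change (((c : ℂ) * (d : ℂ) : ℂ) : ℍ) * _ = _ * (_ * _); simp [mul_assoc]))

/-- The orbit space of the circle action on the intersection of the zero level of `K` with `Σ`,
with the quotient topology. -/
abbrev Compactification (μ M f : ℝ) : Type :=
  MulAction.orbitRel.Quotient Circle (regularizedLevel μ M f)

/-- The projection to the orbit space. -/
def proj (μ M f : ℝ) (x : regularizedLevel μ M f) : Compactification μ M f :=
  Quotient.mk (MulAction.orbitRel Circle (regularizedLevel μ M f)) x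

/-- The atlas at hand makes `S` a smooth embedded submanifold of dimension `d` of `ℍ × ℍ`. (There
is at most one such smooth structure on `S`.) -/
def IsSubmanifold (d : ℕ) (S : Set (ℍ × ℍ)) [ChartedSpace (EuclideanSpace ℝ (Fin d)) S] : Prop :=
  IsManifold (𝓡 d) ∞ S ∧
    Manifold.IsSmoothEmbedding (𝓡 d) 𝓘(ℝ, ℍ × ℍ) ∞ (Subtype.val : S → ℍ × ℍ)

/-- The atlases at hand make the orbit space a smooth quotient manifold of dimension `5`: the
projection is a smooth submersion. (There is at most one such smooth structure on the orbit
space.) -/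
def IsQuotientManifold (μ M f : ℝ)
    [ChartedSpace (EuclideanSpace ℝ (Fin 6)) (regularizedLevel μ M f)]
    [ChartedSpace (EuclideanSpace ℝ (Fin 5)) (Compactification μ M f)] : Prop :=
  IsManifold (𝓡 5) ∞ (Compactification μ M f) ∧
    Manifold.IsSubmersion (𝓡 6) (𝓡 5) ∞ (proj μ M f)

/-- The orbit space is a compactification of the energy surface by means of the
Kustaanheimo-Stiefel mapping: it is compact Hausdorff, and the inverse of the mapping induces a
diffeomorphism of the energy surface onto the dense open set of the orbits with `z ≠ 0`. -/
def IsCompactification (μ M f : ℝ)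
    [ChartedSpace (EuclideanSpace ℝ (Fin 5)) (energySurface μ M f)]
    [ChartedSpace (EuclideanSpace ℝ (Fin 5)) (Compactification μ M f)] : Prop :=
  CompactSpace (Compactification μ M f) ∧ T2Space (Compactification μ M f) ∧
    ∃ j : energySurface μ M f → Compactification μ M f,
      Topology.IsOpenEmbedding j ∧ IsLocalDiffeomorph (𝓡 5) (𝓡 5) ∞ j ∧ DenseRange j ∧
      Set.range j = proj μ M f '' {x | x.1.1 ≠ 0} ∧
      ∀ (y : energySurface μ M f) (x : regularizedLevel μ M f), x.1.1 ≠ 0 →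
        (j y = proj μ M f x ↔ ksMap x.1 = y.1)

end KS

end

/-! Up to scaling put p = √f z - i w / √(8μ) and q = √f z + i w / √(8μ). Since `BL` is the inner
product of z and i w, it is the cross term in |p|² and |q|²: the sum of the two norms encodes K = 0
and their difference encodes the cone. After scaling by 1/√(μM), N_f is S³ × S³
(`mem_regularizedLevel_iff`), and the circle, which commutes with i, acts by left multiplication on
p and q together.

The map (p, q) ↦ (p̄ i p, p̄ q) onto S² × S³ has exactly the orbits as fibres (`exists_circle`). It
has smooth local sections, because x - i x n, normalized, is a unit quaternion over n wherever it is
nonzero (`hopfLift`). Hence N_f/S¹ is homeomorphic to S² × S³, which gives compactness and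
separation, and the projection is a submersion.

K.S. has the same shape: its fibres in N_f with z ≠ 0 are orbits, by `exists_circle` for (z, i w),
and T + f pulls back to K/|z|². Its local lifts are again built from `hopfLift`. The energy surface
itself is S² × ℝ³, because the energy equation determines |Q| from P. Density follows from a curve
in N_f that leaves each point with z = 0.

Existence of the manifold structures is shown by transporting those of the products. The other
conclusions are wanted for every admissible structure, so they use only two universal properties: a
map into an embedded submanifold is smooth when it is smooth in the ambient space
(`IsSubmanifold.contMDiffAt_of_val`), and a map out of the quotient is smooth when its composition
with the projection is (`IsQuotientManifold.contMDiffAt_of_comp`). -/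

open Topology Filter Set

namespace KS

/-! ### Straightening a map with a local right inverse. -/

section General

variable {E E' : Type*} [NormedAddCommGroup E] [NormedSpace ℝ E]
  [NormedAddCommGroup E'] [NormedSpace ℝ E']

/-- A smooth map with a local smooth right inverse is the first component of a local
diffeomorphism that straightens the image of the right inverse. -/
theorem exists_chart_of_retraction [FiniteDimensional ℝ E]
    [FiniteDimensional ℝ E'] (F : Type*) [NormedAddCommGroup F] [NormedSpace ℝ F]
    [FiniteDimensional ℝ F] {r : E → E'} {s : E' → E} {y₀ : E}
    (hr : ∀ᶠ y in 𝓝 y₀, ContDiffAt ℝ ∞ r y) (hs : ∀ᶠ u in 𝓝 (r y₀), ContDiffAt ℝ ∞ s u)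
    (hsy : s (r y₀) = y₀) (hrs : ∀ᶠ u in 𝓝 (r y₀), r (s u) = u)
    (hdim : Module.finrank ℝ E = Module.finrank ℝ E' + Module.finrank ℝ F) :
    ∃ e : OpenPartialHomeomorph E (E' × F), y₀ ∈ e.source ∧
      ContDiffOn ℝ ∞ e e.source ∧ ContDiffOn ℝ ∞ e.symm e.target ∧
      (∀ y, (e y).1 = r y) ∧ ∀ᶠ u in 𝓝 (r y₀), e (s u) = (u, 0) := by
  have htop : (∞ : WithTop ℕ∞) ≠ 0 := by simp
  set A := fderiv ℝ r y₀
  set B := fderiv ℝ s (r y₀)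
  have hA : HasFDerivAt r A y₀ := (hr.self_of_nhds.differentiableAt htop).hasFDerivAt
  have hB : HasFDerivAt s B (r y₀) := (hs.self_of_nhds.differentiableAt htop).hasFDerivAt
  have hAB : A.comp B = ContinuousLinearMap.id ℝ E' := by
    have h1 : HasFDerivAt (r ∘ s) (A.comp B) (r y₀) := by
      refine HasFDerivAt.comp (r y₀) ?_ hB
      rw [hsy]; exact hA
    have h2 : HasFDerivAt (r ∘ s) (ContinuousLinearMap.id ℝ E') (r y₀) :=
      (hasFDerivAt_id _).congr_of_eventuallyEq (hrs.mono fun u hu => hu)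
    exact h1.unique h2
  have hABv (v) : A (B v) = v := congrArg (fun L => L v) hAB
  have hker : Module.finrank ℝ (LinearMap.ker A.toLinearMap) = Module.finrank ℝ F := by
    have h1 := LinearMap.finrank_range_add_finrank_ker A.toLinearMap
    rw [LinearMap.range_eq_top.2 (fun v => ⟨B v, hABv v⟩), finrank_top] at h1
    omega
  -- `P` identifies the kernel of `A` with `F`, which is possible because `A` is onto and the
  -- dimensions match.
  obtain ⟨P₀, hP₀⟩ := LinearMap.exists_extend (LinearEquiv.ofFinrankEq _ _ hker).toLinearMap
  set P : E →L[ℝ] F := P₀.toContinuousLinearMap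
  have hP (v : E) (hv : A v = 0) (hv' : P v = 0) : v = 0 := by
    have h1 := congrArg (fun L => L ⟨v, hv⟩) hP₀
    have h2 : (LinearEquiv.ofFinrankEq _ _ hker) ⟨v, hv⟩ = 0 := by
      rw [← hv']; exact h1.symm
    exact congrArg Subtype.val ((LinearEquiv.map_eq_zero_iff _).1 h2)
  -- Subtracting `s (r y)` makes the second component vanish along the image of `s`, while the
  -- derivative at `y₀` stays injective.
  set χ : E → E' × F := fun y => (r y, P (y - s (r y)))
  have hχ : ∀ᶠ y in 𝓝 y₀, ContDiffAt ℝ ∞ χ y := by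
    filter_upwards [hr, hA.continuousAt.eventually hs] with y h1 h2
    exact h1.prodMk (P.contDiff.contDiffAt.comp y (contDiffAt_id.sub (h2.comp y h1)))
  set D : E →L[ℝ] E' × F := A.prod (P.comp (ContinuousLinearMap.id ℝ E - B.comp A))
  have hD : HasFDerivAt χ D y₀ :=
    hA.prodMk (P.hasFDerivAt.comp y₀ ((hasFDerivAt_id y₀).sub (hB.comp y₀ hA)))
  have hDinj : Function.Injective D := by
    rw [injective_iff_map_eq_zero]
    intro v hv
    have h1 : A v = 0 := congrArg Prod.fst hv
    have h2 : P (v - B (A v)) = 0 := congrArg Prod.snd hv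
    rw [h1, map_zero, sub_zero] at h2
    exact hP v h1 h2
  set D' : E ≃L[ℝ] E' × F := (LinearEquiv.ofInjectiveOfFinrankEq D.toLinearMap hDinj
    (by rw [Module.finrank_prod, hdim])).toContinuousLinearEquiv
  have hD' : (D' : E →L[ℝ] E' × F) = D := by ext v <;> rfl
  have hχ₀ := hχ.self_of_nhds
  rw [← hD'] at hD
  set e₀ := hχ₀.toOpenPartialHomeomorph χ hD htop
  have hinv : ∀ᶠ y in 𝓝 y₀, fderiv ℝ χ y ∈ range ((↑) : (E ≃L[ℝ] E' × F) → E →L[ℝ] E' × F) := by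
    have h1 : ContinuousAt (fderiv ℝ χ) y₀ :=
      (hχ₀.fderiv_right (m := 0) (by simp)).continuousAt
    refine h1.eventually ?_
    rw [hD.fderiv]
    exact ContinuousLinearEquiv.nhds D'
  -- `ContDiffAt ℝ ∞` at `y₀` alone gives neighbourhoods that may shrink with the order. On `O` the
  -- map is smooth with invertible derivative at every point, so the inverse is smooth on the whole
  -- target.
  obtain ⟨O, hO, hOo, hyO⟩ := eventually_nhds_iff.1 (hχ.and hinv)
  refine ⟨e₀.restrOpen O hOo, ⟨hχ₀.mem_toOpenPartialHomeomorph_source hD htop, hyO⟩, ?_, ?_,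
    fun y => rfl, ?_⟩
  · intro y hy
    exact (hO y hy.2).1.contDiffWithinAt
  · intro u hu
    have hu' := (e₀.restrOpen O hOo).map_target hu
    obtain ⟨h1, L, hL⟩ := hO _ hu'.2
    refine ((e₀.restrOpen O hOo).contDiffAt_symm (f₀' := L) hu ?_ h1).contDiffWithinAt
    rw [hL]
    exact (h1.differentiableAt htop).hasFDerivAt
  · filter_upwards [hrs] with u hu
    change (r (s u), P (s u - s (r (s u)))) = (u, 0)
    rw [hu, sub_self, map_zero]

end General

/-! ### Submersions and immersions from local sections and left inverses. -/

section Charts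

variable {E E' : Type*} [NormedAddCommGroup E] [NormedSpace ℝ E]
  [NormedAddCommGroup E'] [NormedSpace ℝ E']
  {M N : Type*} [TopologicalSpace M] [ChartedSpace E M]
  [TopologicalSpace N] [ChartedSpace E' N]

/-- A map that is smooth near a point is smooth near that point when read in charts. -/
theorem eventually_contDiffAt_charts [IsManifold 𝓘(ℝ, E) ∞ M] [IsManifold 𝓘(ℝ, E') ∞ N]
    {f : M → N} {x : M} {c : OpenPartialHomeomorph M E}
    {d : OpenPartialHomeomorph N E'} (hc : c ∈ IsManifold.maximalAtlas 𝓘(ℝ, E) ∞ M)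
    (hd : d ∈ IsManifold.maximalAtlas 𝓘(ℝ, E') ∞ N) (hx : x ∈ c.source) (hfx : f x ∈ d.source)
    (hf : ∀ᶠ y in 𝓝 x, ContMDiffAt 𝓘(ℝ, E) 𝓘(ℝ, E') ∞ f y) :
    ∀ᶠ u in 𝓝 (c x), ContDiffAt ℝ ∞ (fun u => d (f (c.symm u))) u := by
  have h1 := hf.and (hf.self_of_nhds.continuousAt.eventually (d.open_source.mem_nhds hfx))
  have h2 := (c.tendsto_symm hx).eventually h1
  filter_upwards [h2, c.open_target.mem_nhds (c.map_source hx)] with u hu hut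
  rw [← contMDiffAt_iff_contDiffAt]
  exact (contMDiffAt_of_mem_maximalAtlas hd hu.2).comp u
    (hu.1.comp u (contMDiffAt_symm_of_mem_maximalAtlas hc hut))

/-- A chart followed by a local diffeomorphism of the model space is a chart. -/
theorem trans_mem_maximalAtlas [IsManifold 𝓘(ℝ, E) ∞ M] {c : OpenPartialHomeomorph M E}
    (hc : c ∈ IsManifold.maximalAtlas 𝓘(ℝ, E) ∞ M) {e : OpenPartialHomeomorph E E}
    (he : ContDiffOn ℝ ∞ e e.source) (he' : ContDiffOn ℝ ∞ e.symm e.target) :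
    c.trans e ∈ IsManifold.maximalAtlas 𝓘(ℝ, E) ∞ M := by
  rw [IsManifold.mem_maximalAtlas_iff_contMDiffOn]
  constructor
  · exact he.contMDiffOn.comp ((contMDiffOn_of_mem_maximalAtlas hc).mono fun y hy => hy.1)
      fun y hy => hy.2
  · exact (contMDiffOn_symm_of_mem_maximalAtlas hc).comp (he'.contMDiffOn.mono fun y hy => hy.1)
      fun y hy => hy.2

/-- A smooth map with a smooth local section is a submersion. -/
theorem isSubmersionAtOfComplement_of_section [FiniteDimensional ℝ E] [FiniteDimensional ℝ E']
    [IsManifold 𝓘(ℝ, E) ∞ M] [IsManifold 𝓘(ℝ, E') ∞ N]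
    (F : Type*) [NormedAddCommGroup F] [NormedSpace ℝ F] [FiniteDimensional ℝ F]
    (hdim : Module.finrank ℝ E = Module.finrank ℝ E' + Module.finrank ℝ F)
    {f : M → N} {s : N → M} {x : M}
    (hf : ∀ᶠ y in 𝓝 x, ContMDiffAt 𝓘(ℝ, E) 𝓘(ℝ, E') ∞ f y)
    (hs : ∀ᶠ c in 𝓝 (f x), ContMDiffAt 𝓘(ℝ, E') 𝓘(ℝ, E) ∞ s c)
    (hsx : s (f x) = x) (hfs : ∀ᶠ c in 𝓝 (f x), f (s c) = c) :
    Manifold.IsSubmersionAtOfComplement F 𝓘(ℝ, E) 𝓘(ℝ, E') ∞ f x := by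
  set c := chartAt E x
  set d := chartAt E' (f x)
  have hc : c ∈ IsManifold.maximalAtlas 𝓘(ℝ, E) ∞ M := IsManifold.chart_mem_maximalAtlas x
  have hd : d ∈ IsManifold.maximalAtlas 𝓘(ℝ, E') ∞ N := IsManifold.chart_mem_maximalAtlas (f x)
  have hx : x ∈ c.source := mem_chart_source E x
  have hfx : f x ∈ d.source := mem_chart_source E' (f x)
  have hcx : c.symm (c x) = x := c.left_inv hx
  have hdx : d.symm (d (f x)) = f x := d.left_inv hfx
  have hsx' : s (f x) ∈ c.source := by rw [hsx]; exact hx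
  -- The straightening of `f` by its section corrects the domain chart; the codomain chart is kept.
  have key := exists_chart_of_retraction F (r := fun u => d (f (c.symm u)))
    (s := fun u => c (s (d.symm u))) (y₀ := c x)
    (eventually_contDiffAt_charts hc hd hx hfx hf)
    (by simpa only [hcx] using eventually_contDiffAt_charts hd hc hfx hsx' hs)
    (by simp only [hcx, hdx, hsx]) ?_ hdim
  · obtain ⟨e, hxe, he, he', her, -⟩ := key
    set L : E ≃L[ℝ] E' × F := ContinuousLinearEquiv.ofFinrankEq
      (by rw [Module.finrank_prod, hdim])
    set e₁ : OpenPartialHomeomorph E E := e.trans L.symm.toHomeomorph.toOpenPartialHomeomorph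
    refine .mk_of_continuousAt hf.self_of_nhds.continuousAt L (c.trans e₁) d ?_ hfx
      (trans_mem_maximalAtlas hc ?_ ?_) hd ?_
    · simpa [e₁, hx] using hxe
    · exact L.symm.contDiff.comp_contDiffOn (he.mono fun y hy => hy.1)
    · exact he'.comp L.contDiff.contDiffOn fun y hy => hy.2
    · intro v hv
      have hv' : L v ∈ e.target := by
        have := hv
        simp only [OpenPartialHomeomorph.extend_target] at this
        have h2 : v ∈ e₁.target := (inter_subset_left this).1
        exact h2.2
      change d (f (c.symm (e.symm (L v)))) = (L v).1
      rw [← her, e.right_inv hv']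
  · rw [hcx]
    have h1 : Tendsto d.symm (𝓝 (d (f x))) (𝓝 (f x)) := d.tendsto_symm hfx
    have h2 := h1.eventually hfs
    have h3 : ∀ᶠ y in 𝓝 (f x), s y ∈ c.source :=
      hs.self_of_nhds.continuousAt.eventually (c.open_source.mem_nhds hsx')
    filter_upwards [h2, h1.eventually h3, d.open_target.mem_nhds (d.map_source hfx)]
      with u h4 h5 h6
    simp only [c.left_inv h5, h4, d.right_inv h6]

/-- A smooth map with a smooth local left inverse is an immersion. -/
theorem isImmersionAtOfComplement_of_leftInverse [FiniteDimensional ℝ E] [FiniteDimensional ℝ E']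
    [IsManifold 𝓘(ℝ, E) ∞ M] [IsManifold 𝓘(ℝ, E') ∞ N]
    (F : Type*) [NormedAddCommGroup F] [NormedSpace ℝ F] [FiniteDimensional ℝ F]
    (hdim : Module.finrank ℝ E' = Module.finrank ℝ E + Module.finrank ℝ F)
    {f : M → N} {g : N → M} {x : M}
    (hf : ∀ᶠ y in 𝓝 x, ContMDiffAt 𝓘(ℝ, E) 𝓘(ℝ, E') ∞ f y)
    (hg : ∀ᶠ c in 𝓝 (f x), ContMDiffAt 𝓘(ℝ, E') 𝓘(ℝ, E) ∞ g c)
    (hgf : ∀ᶠ y in 𝓝 x, g (f y) = y) :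
    Manifold.IsImmersionAtOfComplement F 𝓘(ℝ, E) 𝓘(ℝ, E') ∞ f x := by
  set c := chartAt E x
  set d := chartAt E' (f x)
  have hc : c ∈ IsManifold.maximalAtlas 𝓘(ℝ, E) ∞ M := IsManifold.chart_mem_maximalAtlas x
  have hd : d ∈ IsManifold.maximalAtlas 𝓘(ℝ, E') ∞ N := IsManifold.chart_mem_maximalAtlas (f x)
  have hx : x ∈ c.source := mem_chart_source E x
  have hfx : f x ∈ d.source := mem_chart_source E' (f x)
  have hcx : c.symm (c x) = x := c.left_inv hx
  have hdx : d.symm (d (f x)) = f x := d.left_inv hfx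
  have hgx : g (f x) = x := hgf.self_of_nhds
  have hgx' : g (f x) ∈ c.source := by rw [hgx]; exact hx
  -- The roles are exchanged: `g` is the retraction and `f` its section, so the straightening
  -- corrects the codomain chart. The domain chart is later cut down to `O`, where `e (s u) = (u,
  -- 0)` holds.
  have key := exists_chart_of_retraction F (r := fun u => c (g (d.symm u)))
    (s := fun u => d (f (c.symm u))) (y₀ := d (f x))
    (eventually_contDiffAt_charts hd hc hfx hgx' hg)
    (by simpa only [hdx, hgx] using eventually_contDiffAt_charts hc hd hx hfx hf)
    (by simp only [hcx, hdx, hgx]) ?_ hdim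
  · obtain ⟨e, hxe, he, he', -, hes⟩ := key
    rw [hdx, hgx] at hes
    obtain ⟨O, hO, hOo, hxO⟩ := eventually_nhds_iff.1 hes
    set L : (E × F) ≃L[ℝ] E' := ContinuousLinearEquiv.ofFinrankEq
      (by rw [Module.finrank_prod, hdim])
    set e₁ : OpenPartialHomeomorph E' E' := e.trans L.toHomeomorph.toOpenPartialHomeomorph
    refine .mk_of_continuousAt hf.self_of_nhds.continuousAt L
      (c.restr (c ⁻¹' O ∩ c.source)) (d.trans e₁) ?_ ?_
      (restr_mem_maximalAtlas _ hc ?_) (trans_mem_maximalAtlas hd ?_ ?_) ?_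
    · have h1 : IsOpen (c ⁻¹' O ∩ c.source) := by
        rw [inter_comm]; exact c.isOpen_inter_preimage hOo
      rw [c.restr_source' _ h1]
      exact ⟨hx, hxO, hx⟩
    · simpa [e₁, hfx] using hxe
    · rw [inter_comm]; exact c.isOpen_inter_preimage hOo
    · exact L.contDiff.comp_contDiffOn (he.mono fun y hy => hy.1)
    · exact he'.comp L.symm.contDiff.contDiffOn fun y hy => hy.2
    · intro v hv
      have hv' : v ∈ c.target ∧ v ∈ O := by
        have h1 := hv
        simp only [OpenPartialHomeomorph.extend_target] at h1
        have h2 : v ∈ c.target ∧ c.symm v ∈ interior (c ⁻¹' O ∩ c.source) :=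
          h1.1
        have h3 := (interior_subset h2.2).1
        rw [mem_preimage, c.right_inv h2.1] at h3
        exact ⟨h2.1, h3⟩
      change L (e (d (f (c.symm v)))) = L (v, 0)
      rw [hO v hv'.2]
  · rw [hdx, hgx]
    have h1 : Tendsto c.symm (𝓝 (c x)) (𝓝 x) := c.tendsto_symm hx
    have h3 : ∀ᶠ y in 𝓝 x, f y ∈ d.source :=
      hf.self_of_nhds.continuousAt.eventually (d.open_source.mem_nhds hfx)
    filter_upwards [h1.eventually hgf, h1.eventually h3, c.open_target.mem_nhds (c.map_source hx)]
      with u h4 h5 h6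
    simp only [d.left_inv h5, h4, c.right_inv h6]

/-- A submersion has a smooth local section through every point. -/
theorem exists_section_of_isSubmersion {f : M → N}
    (hf : Manifold.IsSubmersion 𝓘(ℝ, E) 𝓘(ℝ, E') ∞ f) (x : M) :
    ∃ s : N → M, s (f x) = x ∧ (∀ᶠ c in 𝓝 (f x), f (s c) = c) ∧
      ContMDiffAt 𝓘(ℝ, E') 𝓘(ℝ, E) ∞ s (f x) := by
  have h := hf.isSubmersionOfComplement_complement x
  set c := h.domChart
  set d := h.codChart
  set L := h.equiv
  have hx : x ∈ c.source := h.mem_domChart_source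
  have hfx : f x ∈ d.source := h.mem_codChart_source
  have hw (v) (hv : v ∈ c.target) : d (f (c.symm v)) = (L v).1 :=
    h.writtenInCharts (by simpa using hv)
  have hdx : d (f x) = (L (c x)).1 := by rw [← hw _ (c.map_source hx), c.left_inv hx]
  -- The complementary coordinate is frozen at its value at `x`, so that the section passes through
  -- `x`.
  set t : N → E := fun y => L.symm (d y, (L (c x)).2) with ht
  have htx : t (f x) = c x := by simp [ht, hdx]
  have htd : ContMDiffAt 𝓘(ℝ, E') 𝓘(ℝ, E) ∞ t (f x) := by
    have h1 : ContDiff ℝ ∞ (fun u : E' => L.symm (u, (L (c x)).2)) :=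
      L.symm.contDiff.comp (contDiff_id.prodMk contDiff_const)
    exact h1.contMDiff.contMDiffAt.comp (f x)
      (contMDiffAt_of_mem_maximalAtlas h.codChart_mem_maximalAtlas hfx)
  have htt : ∀ᶠ y in 𝓝 (f x), t y ∈ c.target :=
    htd.continuousAt.eventually (c.open_target.mem_nhds (by rw [htx]; exact c.map_source hx))
  refine ⟨fun y => c.symm (t y), ?_, ?_, ?_⟩
  · change c.symm (t (f x)) = x
    rw [htx, c.left_inv hx]
  · filter_upwards [htt, d.open_source.mem_nhds hfx] with y hy hyd
    have h1 : f (c.symm (t y)) ∈ d.source := h.source_subset_preimage_source (c.map_target hy)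
    apply d.injOn h1 hyd
    rw [hw _ hy]
    simp [ht]
  · refine ContMDiffAt.comp (f x) (contMDiffAt_symm_of_mem_maximalAtlas
      h.domChart_mem_maximalAtlas htt.self_of_nhds) htd

end Charts

/-! ### Smoothness of maps into a sphere. -/

section Sphere

variable {E : Type*} [NormedAddCommGroup E] [InnerProductSpace ℝ E] {n : ℕ}
  [Fact (Module.finrank ℝ E = n + 1)]
  {F H M : Type*} [NormedAddCommGroup F] [NormedSpace ℝ F] [TopologicalSpace H]
  {I : ModelWithCorners ℝ F H} [TopologicalSpace M] [ChartedSpace H M]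

/-- A map into the unit sphere is smooth at a point if it is smooth there as a map into the
ambient space. -/
theorem contMDiffAt_sphere_of_coe {f : M → Metric.sphere (0 : E) 1} {x : M}
    (hf : ContMDiffAt I 𝓘(ℝ, E) ∞ (fun y => (f y : E)) x) : ContMDiffAt I (𝓡 n) ∞ f x := by
  rw [contMDiffAt_iff_target]
  refine ⟨IsInducing.subtypeVal.continuousAt_iff.2 hf.continuousAt, ?_⟩
  set v := f x
  -- The chart at `v` is stereographic projection from `-v`, whose formula is smooth in the ambient
  -- space where the inner product with `-v` is not 1; at `v` that product is -1.
  let U := (OrthonormalBasis.fromOrthogonalSpanSingleton (𝕜 := ℝ)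
        n (ne_zero_of_mem_unit_sphere (-v))).repr
  have h1 : ContDiffOn ℝ ∞ (fun y : E => U (stereoToFun (-v : E) y))
      {y : E | innerSL ℝ (-v : E) y ≠ 1} :=
    U.contDiff.comp_contDiffOn contDiffOn_stereoToFun
  have hopen : IsOpen {y : E | innerSL ℝ (-v : E) y ≠ 1} :=
    isOpen_ne_fun (by fun_prop) continuous_const
  have hv : (v : E) ∈ {y : E | innerSL ℝ (-v : E) y ≠ 1} := by
    have : ‖(v : E)‖ = 1 := norm_eq_of_mem_sphere v
    simp [this]
    norm_num
  have h2 := (h1.contDiffAt (hopen.mem_nhds hv)).contMDiffAt.comp x hf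
  exact h2

end Sphere

/-! ### Manifold structures carried along a homeomorphism. -/

section Transport

variable {E E' H X Y : Type*} [NormedAddCommGroup E] [NormedSpace ℝ E]
  [NormedAddCommGroup E'] [NormedSpace ℝ E'] [TopologicalSpace H]
  (I : ModelWithCorners ℝ E H) [TopologicalSpace X] [TopologicalSpace Y] [ChartedSpace H Y]

/-- The structure of a charted space carried along a homeomorphism and a linear isomorphism of the
model spaces. -/
@[reducible] noncomputable def transportChartedSpace [I.Boundaryless] (h : X ≃ₜ Y)
    (L : E ≃L[ℝ] E') : ChartedSpace E' X where
  atlas := range fun y : Y => h.toOpenPartialHomeomorph.trans ((chartAt H y).trans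
    (I.toHomeomorph.trans L.toHomeomorph).toOpenPartialHomeomorph)
  chartAt x := h.toOpenPartialHomeomorph.trans ((chartAt H (h x)).trans
    (I.toHomeomorph.trans L.toHomeomorph).toOpenPartialHomeomorph)
  mem_chart_source x := by simp
  chart_mem_atlas x := ⟨h x, rfl⟩

/-- In a transition map `h` cancels, leaving a coordinate change of `Y` conjugated by `L`. -/
theorem isManifold_transport [I.Boundaryless] [IsManifold I ∞ Y] (h : X ≃ₜ Y) (L : E ≃L[ℝ] E') :
    letI := transportChartedSpace I h L
    IsManifold 𝓘(ℝ, E') ∞ X := by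
  let _ := transportChartedSpace I h L
  refine isManifold_of_contDiffOn _ _ _ ?_
  rintro _ _ ⟨y, rfl⟩ ⟨y', rfl⟩
  have h1 := contDiffOn_ext_coord_change (I := I) (n := ∞) y' y
  have h2 := L.contDiff.comp_contDiffOn (h1.comp (f := L.symm) (s := {u | L.symm u ∈
    ((extChartAt I y).symm.trans (extChartAt I y')).source})
    L.symm.contDiff.contDiffOn fun u hu => hu)
  refine (h2.congr ?_).mono ?_
  · intro u hu
    simp [ModelWithCorners.toHomeomorph]
  · rintro u ⟨hu, -⟩
    have hr : L.symm u ∈ range I := I.range_eq_univ ▸ mem_univ _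
    simpa [ModelWithCorners.toHomeomorph, PartialEquiv.trans_source, extChartAt, hr.out] using hu

/-- Read in the transported chart at `x` and the extended chart at `h x`, the map `h` is just
`L.symm`. -/
theorem contMDiff_transport [I.Boundaryless] [IsManifold I ∞ Y] (h : X ≃ₜ Y) (L : E ≃L[ℝ] E') :
    letI := transportChartedSpace I h L
    ContMDiff 𝓘(ℝ, E') I ∞ h := by
  let _ := transportChartedSpace I h L
  have := isManifold_transport I h L
  intro x
  have h1 : ContMDiffAt 𝓘(ℝ, E') 𝓘(ℝ, E') ∞ (chartAt E' x) x := by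
    exact contMDiffAt_of_mem_maximalAtlas (IsManifold.chart_mem_maximalAtlas x)
      (mem_chart_source E' x)
  have h2 : ContMDiffAt 𝓘(ℝ, E) I ∞ (extChartAt I (h x)).symm (extChartAt I (h x) (h x)) :=
    (contMDiffOn_extChartAt_symm (h x)).contMDiffAt (extChartAt_target_mem_nhds (h x))
  have h3 : L.symm (chartAt E' x x) = extChartAt I (h x) (h x) := L.symm_apply_apply _
  have h4 : ContMDiffAt 𝓘(ℝ, E') I ∞
      (fun z => (extChartAt I (h x)).symm (L.symm (chartAt E' x z))) x := by
    refine ContMDiffAt.comp x (g := (extChartAt I (h x)).symm) (by rw [h3]; exact h2) ?_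
    exact L.symm.contDiff.contMDiff.contMDiffAt.comp x h1
  refine h4.congr_of_eventuallyEq ?_
  filter_upwards [h.continuous.continuousAt.eventually (extChartAt_source_mem_nhds (I := I) (h x))]
    with z hz
  have h5 : L.symm (chartAt E' x z) = extChartAt I (h x) (h z) := L.symm_apply_apply _
  rw [h5, (extChartAt I (h x)).left_inv hz]

theorem contMDiff_transport_symm [I.Boundaryless] [IsManifold I ∞ Y] (h : X ≃ₜ Y)
    (L : E ≃L[ℝ] E') :
    letI := transportChartedSpace I h L
    ContMDiff I 𝓘(ℝ, E') ∞ h.symm := by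
  let _ := transportChartedSpace I h L
  have := isManifold_transport I h L
  intro y
  have h1 : ContMDiffAt I 𝓘(ℝ, E) ∞ (extChartAt I y) y := contMDiffAt_extChartAt
  have h2 : ContMDiffAt 𝓘(ℝ, E') 𝓘(ℝ, E') ∞ (chartAt E' (h.symm y)).symm
      (chartAt E' (h.symm y) (h.symm y)) := by
    exact contMDiffAt_symm_of_mem_maximalAtlas (IsManifold.chart_mem_maximalAtlas (h.symm y))
      (mem_chart_target E' _)
  have h3 (z) : chartAt E' (h.symm y) (h.symm z) = L (extChartAt I y z) := by
    change L (extChartAt I (h (h.symm y)) (h (h.symm z))) = _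
    rw [h.apply_symm_apply, h.apply_symm_apply]
  have h4 : ContMDiffAt I 𝓘(ℝ, E') ∞
      (fun z => (chartAt E' (h.symm y)).symm (L (extChartAt I y z))) y := by
    refine ContMDiffAt.comp y (g := (chartAt E' (h.symm y)).symm) (by rw [← h3]; exact h2) ?_
    exact L.contDiff.contMDiff.contMDiffAt.comp y h1
  refine h4.congr_of_eventuallyEq ?_
  filter_upwards [h.symm.continuous.continuousAt.eventually
    ((chartAt E' (h.symm y)).open_source.mem_nhds (mem_chart_source E' (h.symm y)))]
    with z hz
  rw [← h3, (chartAt E' (h.symm y)).left_inv hz]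

end Transport

/-! ### Quaternion algebra, the Hopf map and its local lifts. -/

section Quaternions

theorem qi_re : qi.re = 0 := rfl
theorem qi_imI : qi.imI = 1 := rfl
theorem qi_imJ : qi.imJ = 0 := rfl
theorem qi_imK : qi.imK = 0 := rfl

theorem qi_mul_qi : qi * qi = -1 := by
  ext <;> simp [qi_re, qi_imI, qi_imJ, qi_imK]

theorem qi_mul_qi_mul (a : ℍ) : qi * (qi * a) = -a := by
  rw [← mul_assoc, qi_mul_qi, neg_one_mul]

theorem norm_qi : ‖qi‖ = 1 := by
  have h := congrArg norm qi_mul_qi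
  rw [norm_mul, norm_neg, norm_one] at h
  nlinarith [norm_nonneg qi]

theorem qi_mul_inj {a b : ℍ} (h : qi * a = qi * b) : a = b := by
  have := congrArg (qi * ·) h
  simpa [qi_mul_qi_mul] using this

theorem star_mul_self_smul (a : ℍ) : star a * a = ((‖a‖ ^ 2 : ℝ) : ℍ) := by
  rw [Quaternion.star_mul_self, Quaternion.normSq_eq_norm_mul_self, sq]

theorem star_mul_self_of_norm {a : ℍ} (h : ‖a‖ = 1) : star a * a = 1 := by
  simp [star_mul_self_smul, h]

theorem mul_star_self_of_norm {a : ℍ} (h : ‖a‖ = 1) : a * star a = 1 := by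
  simp [Quaternion.self_mul_star, Quaternion.normSq_eq_norm_mul_self, h]

theorem star_conj_re (a : ℍ) : (star a * qi * a).re = 0 := by
  simp [qi_re, qi_imI, qi_imJ, qi_imK]
  ring

theorem mul_self_of_re_eq_zero {n : ℍ} (hn : n.re = 0) (h : ‖n‖ = 1) : n * n = -1 := by
  have h1 : star n = -n := Quaternion.star_eq_neg.2 hn
  have h2 := star_mul_self_of_norm h
  rw [h1, neg_mul] at h2
  rw [← h2, neg_neg]

theorem circle_mul_qi (c : Circle) : ((c : ℂ) : ℍ) * qi = qi * ((c : ℂ) : ℍ) := by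
  ext <;> simp [qi_re, qi_imI, qi_imJ, qi_imK]

theorem star_circle_mul (c : Circle) : star ((c : ℂ) : ℍ) * ((c : ℂ) : ℍ) = 1 :=
  star_mul_self_of_norm (norm_circle c)

/-- The unit quaternions that commute with `i` form the circle. -/
theorem exists_circle_of_commute {g : ℍ} (hg : g * qi = qi * g) (h : ‖g‖ = 1) :
    ∃ c : Circle, ((c : ℂ) : ℍ) = g := by
  have h1 := congrArg QuaternionAlgebra.imJ hg
  have h2 := congrArg QuaternionAlgebra.imK hg
  simp [qi_re, qi_imI, qi_imJ, qi_imK] at h1 h2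
  have hJ : g.imJ = 0 := by linarith
  have hK : g.imK = 0 := by linarith
  have h3 : Quaternion.normSq g = 1 := by rw [Quaternion.normSq_eq_norm_mul_self, h, one_mul]
  rw [Quaternion.normSq_def', hJ, hK] at h3
  refine ⟨⟨⟨g.re, g.imI⟩, ?_⟩, ?_⟩
  · apply mem_sphere_zero_iff_norm.2
    rw [← pow_eq_one_iff_of_nonneg (norm_nonneg _) two_ne_zero, Complex.sq_norm,
      Complex.normSq_mk]
    linarith
  · ext <;> simp [hJ, hK]

theorem norm_star_conj (z w : ℍ) : ‖star z * qi * w‖ = ‖z‖ * ‖w‖ := by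
  rw [norm_mul, norm_mul, norm_qi, norm_star, mul_one]

/-- The fibres of the Hopf-type map `(z, w) ↦ (z̄ i z, z̄ w)` are the orbits of the circle. -/
theorem exists_circle {z z' w w' : ℍ} (hz : z ≠ 0) (h1 : star z * qi * z = star z' * qi * z')
    (h2 : star z * w = star z' * w') :
    ∃ c : Circle, z' = ((c : ℂ) : ℍ) * z ∧ w' = ((c : ℂ) : ℍ) * w := by
  have hn : ‖z‖ = ‖z'‖ := by
    have h := congrArg norm h1
    rw [norm_star_conj, norm_star_conj] at h
    nlinarith [norm_nonneg z, norm_nonneg z', norm_pos_iff.2 hz]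
  have hz' : z' ≠ 0 := by
    rw [← norm_ne_zero_iff, ← hn]; exact norm_ne_zero_iff.2 hz
  have hs : z * star z = z' * star z' := by
    rw [Quaternion.self_mul_star, Quaternion.self_mul_star, Quaternion.normSq_eq_norm_mul_self,
      Quaternion.normSq_eq_norm_mul_self, hn]
  have hst : star z * z = star z' * z' := by
    rw [star_mul_self_smul, star_mul_self_smul, hn]
  have hsz : star z' ≠ 0 := star_ne_zero.2 hz'
  -- The only candidate for the circle element. Equal norms give z̄' g = z̄; combined with `h2` this
  -- gives g w = w', and with `h1` that g commutes with i.
  set g : ℍ := z' * z⁻¹ with hg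
  have hgz : g * z = z' := by rw [hg, mul_assoc, inv_mul_cancel₀ hz, mul_one]
  have hgs : star z' * g = star z := by
    apply mul_right_cancel₀ hz
    rw [mul_assoc, hgz, hst]
  have hgw : g * w = w' := by
    apply mul_left_cancel₀ hsz
    rw [← mul_assoc, hgs, h2]
  have hgi : g * qi = qi * g := by
    apply mul_left_cancel₀ hsz
    apply mul_right_cancel₀ hz
    rw [← mul_assoc, hgs, h1, mul_assoc (star z'), mul_assoc (star z'), mul_assoc qi, hgz]
  have hgn : ‖g‖ = 1 := by
    rw [hg, norm_mul, norm_inv, hn, mul_inv_cancel₀ (norm_ne_zero_iff.2 hz')]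
  obtain ⟨c, hc⟩ := exists_circle_of_commute hgi hgn
  exact ⟨c, by rw [hc, hgz], by rw [hc, hgw]⟩

/-- A unit quaternion close to the direction of `x` which the Hopf map sends to `n`. -/
noncomputable def hopfLift (x n : ℍ) : ℍ := ‖x - qi * x * n‖⁻¹ • (x - qi * x * n)

theorem norm_hopfLift {x n : ℍ} (hu : x - qi * x * n ≠ 0) : ‖hopfLift x n‖ = 1 := by
  rw [hopfLift, norm_smul, norm_inv, norm_norm, inv_mul_cancel₀ (norm_ne_zero_iff.2 hu)]

/-- From i² = n² = -1, the quaternion u = x - i x n satisfies i u = i x + x n = u n. Hence ū i u =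
|u|² n, which is why the normalized u lies over n. -/
theorem qi_mul_hopfLift {x n : ℍ} (hn : n.re = 0) (hn' : ‖n‖ = 1) :
    qi * hopfLift x n = hopfLift x n * n := by
  rw [hopfLift, mul_smul_comm, smul_mul_assoc]
  congr 1
  rw [mul_sub, sub_mul, mul_assoc qi x n, qi_mul_qi_mul, mul_assoc qi, mul_assoc x,
    mul_self_of_re_eq_zero hn hn']
  noncomm_ring

theorem star_hopfLift {x n : ℍ} (hn : n.re = 0) (hn' : ‖n‖ = 1) (hu : x - qi * x * n ≠ 0) :
    star (hopfLift x n) * qi * hopfLift x n = n := by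
  rw [mul_assoc, qi_mul_hopfLift hn hn', ← mul_assoc, star_mul_self_of_norm (norm_hopfLift hu),
    one_mul]

theorem mul_star_conj (x : ℍ) (a : ℍ) (hx : x ≠ 0) :
    x * ((‖x‖ ^ 2)⁻¹ • (star x * qi * a)) = qi * a := by
  have hx' : ‖x‖ ≠ 0 := norm_ne_zero_iff.2 hx
  rw [mul_smul_comm, ← mul_assoc, ← mul_assoc, Quaternion.self_mul_star,
    Quaternion.normSq_eq_norm_mul_self, mul_assoc, Quaternion.coe_mul_eq_smul, smul_smul, ← sq,
    inv_mul_cancel₀ (pow_ne_zero 2 hx'), one_smul]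

/-- At the Hopf image of x the unnormalized lift is 2x: the lift is therefore defined near that
point and passes through the direction of x. -/
theorem sub_qi_mul_hopf {x : ℍ} (hx : x ≠ 0) :
    x - qi * x * ((‖x‖ ^ 2)⁻¹ • (star x * qi * x)) = (2 : ℝ) • x := by
  rw [mul_assoc, mul_star_conj x x hx, qi_mul_qi_mul, sub_neg_eq_add, two_smul]

theorem hopfLift_hopf {x : ℍ} (hx : x ≠ 0) :
    hopfLift x ((‖x‖ ^ 2)⁻¹ • (star x * qi * x)) = ‖x‖⁻¹ • x := by
  rw [hopfLift, sub_qi_mul_hopf hx, norm_smul, smul_smul]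
  congr 1
  norm_num
  field_simp

/-- If both x = 1 and x = j failed, the first would force the i-component of n to be -1 and the
second would force it to be 1. -/
theorem exists_sub_qi_mul_ne (n : ℍ) : ∃ x : ℍ, x - qi * x * n ≠ 0 := by
  obtain ⟨j, j0, j1, j2, j3⟩ : ∃ j : ℍ, j.re = 0 ∧ j.imI = 0 ∧ j.imJ = 1 ∧ j.imK = 0 :=
    ⟨⟨0, 0, 1, 0⟩, rfl, rfl, rfl, rfl⟩
  by_contra! h
  have h2 := congrArg QuaternionAlgebra.re (h 1)
  have h3 := congrArg QuaternionAlgebra.imJ (h j)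
  simp [qi_re, qi_imI, qi_imJ, qi_imK, j0, j1, j2, j3] at h2 h3
  linarith

theorem contDiffAt_hopfLift {x n : ℍ} (hu : x - qi * x * n ≠ 0) :
    ContDiffAt ℝ ∞ (hopfLift x) n := by
  have h1 : ContDiffAt ℝ ∞ (fun n : ℍ => x - qi * x * n) n := by fun_prop
  exact ((h1.norm ℝ hu).inv (norm_ne_zero_iff.2 hu)).smul h1

theorem BL_eq_inner (x : ℍ × ℍ) : BL x = inner ℝ x.1 (qi * x.2) := by
  rw [BL, Quaternion.inner_def]
  simp [qi_re, qi_imI, qi_imJ, qi_imK]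
  ring

end Quaternions

/-! ### Identifications with ℝ³ and ℝ⁴. -/

section Linear

/-- The linear inclusion of `ℝ³` as the purely imaginary quaternions. -/
noncomputable def ofVec : EuclideanSpace ℝ (Fin 3) →L[ℝ] ℍ :=
  LinearMap.toContinuousLinearMap
    { toFun := fun v => ⟨0, v 0, v 1, v 2⟩
      map_add' := fun v w => by ext; exacts [(add_zero (0 : ℝ)).symm, rfl, rfl, rfl]
      map_smul' := fun r v => by ext; exacts [(mul_zero r).symm, rfl, rfl, rfl] }

/-- The imaginary part of a quaternion as a vector of `ℝ³`. -/
noncomputable def toVec : ℍ →L[ℝ] EuclideanSpace ℝ (Fin 3) :=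
  LinearMap.toContinuousLinearMap
    { toFun := fun q => !₂[q.imI, q.imJ, q.imK]
      map_add' := fun v w => by ext i; fin_cases i <;> simp
      map_smul' := fun r v => by ext i; fin_cases i <;> simp }

theorem toVec_ofVec (v : EuclideanSpace ℝ (Fin 3)) : toVec (ofVec v) = v := by
  ext i; fin_cases i <;> rfl

theorem ofVec_re (v : EuclideanSpace ℝ (Fin 3)) : (ofVec v).re = 0 := rfl

theorem ofVec_toVec {q : ℍ} (hq : q.re = 0) : ofVec (toVec q) = q := by
  ext
  · exact hq.symm
  all_goals rfl

theorem norm_ofVec (v : EuclideanSpace ℝ (Fin 3)) : ‖ofVec v‖ = ‖v‖ := by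
  have h1 : ‖ofVec v‖ ^ 2 = ‖v‖ ^ 2 := by
    rw [EuclideanSpace.real_norm_sq_eq, Fin.sum_univ_three, sq ‖ofVec v‖,
      ← Quaternion.normSq_eq_norm_mul_self, Quaternion.normSq_def']
    change (0 : ℝ) ^ 2 + v 0 ^ 2 + v 1 ^ 2 + v 2 ^ 2 = _
    ring
  exact (sq_eq_sq₀ (norm_nonneg _) (norm_nonneg _)).1 h1

theorem norm_toVec {q : ℍ} (hq : q.re = 0) : ‖toVec q‖ = ‖q‖ := by
  rw [← norm_ofVec, ofVec_toVec hq]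

/-- The isometry of the quaternions with `ℝ⁴`. -/
noncomputable def e4 : ℍ ≃ₗᵢ[ℝ] EuclideanSpace ℝ (Fin 4) := Quaternion.linearIsometryEquivTuple

end Linear

/-! ### Linear coordinates that turn the level into a product of spheres. -/

section Level

variable (μ M f : ℝ)

/-- The first of the linear coordinates in which the regularized level is a product of spheres. -/
noncomputable def toP (x : ℍ × ℍ) : ℍ :=
  (√(μ * M))⁻¹ • (√f • x.1 - (√(8 * μ))⁻¹ • (qi * x.2))

/-- The second of the linear coordinates in which the regularized level is a product of spheres. -/
noncomputable def toQ (x : ℍ × ℍ) : ℍ :=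
  (√(μ * M))⁻¹ • (√f • x.1 + (√(8 * μ))⁻¹ • (qi * x.2))

/-- The inverse of the linear change of coordinates given by `toP` and `toQ`. -/
noncomputable def ofPQ (p q : ℍ) : ℍ × ℍ :=
  ((√(μ * M) / (2 * √f)) • (p + q), (√(μ * M) * √(8 * μ) / 2) • (qi * (p - q)))

theorem contDiff_toP : ContDiff ℝ ∞ (toP μ M f) := by
  unfold toP; fun_prop

theorem contDiff_toQ : ContDiff ℝ ∞ (toQ μ M f) := by
  unfold toQ; fun_prop

theorem contDiff_ofPQ : ContDiff ℝ ∞ (fun x : ℍ × ℍ => ofPQ μ M f x.1 x.2) := by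
  unfold ofPQ; fun_prop

theorem toP_circle (c : Circle) (x : ℍ × ℍ) :
    toP μ M f (((c : ℂ) : ℍ) * x.1, ((c : ℂ) : ℍ) * x.2) = ((c : ℂ) : ℍ) * toP μ M f x := by
  simp only [toP, mul_smul_comm, mul_sub, ← mul_assoc, circle_mul_qi]

theorem toQ_circle (c : Circle) (x : ℍ × ℍ) :
    toQ μ M f (((c : ℂ) : ℍ) * x.1, ((c : ℂ) : ℍ) * x.2) = ((c : ℂ) : ℍ) * toQ μ M f x := by
  simp only [toQ, mul_smul_comm, mul_add, ← mul_assoc, circle_mul_qi]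

theorem ofPQ_circle (c : Circle) (p q : ℍ) :
    ofPQ μ M f (((c : ℂ) : ℍ) * p) (((c : ℂ) : ℍ) * q) =
      (((c : ℂ) : ℍ) * (ofPQ μ M f p q).1, ((c : ℂ) : ℍ) * (ofPQ μ M f p q).2) := by
  simp only [ofPQ, ← mul_add, ← mul_sub, mul_smul_comm]
  simp only [← mul_assoc, circle_mul_qi]

variable {μ M f}

theorem toP_ofPQ (hμ : 0 < μ) (hM : 0 < M) (hf : 0 < f) (p q : ℍ) :
    toP μ M f (ofPQ μ M f p q) = p := by
  have h1 : √(μ * M) ≠ 0 := (Real.sqrt_pos.2 (by positivity)).ne'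
  have h2 : √f ≠ 0 := (Real.sqrt_pos.2 hf).ne'
  have h3 : √(8 * μ) ≠ 0 := (Real.sqrt_pos.2 (by positivity)).ne'
  simp only [toP, ofPQ, mul_smul_comm, qi_mul_qi_mul, smul_sub, smul_add, smul_neg, smul_smul]
  match_scalars <;> field_simp <;> norm_num

theorem toQ_ofPQ (hμ : 0 < μ) (hM : 0 < M) (hf : 0 < f) (p q : ℍ) :
    toQ μ M f (ofPQ μ M f p q) = q := by
  have h1 : √(μ * M) ≠ 0 := (Real.sqrt_pos.2 (by positivity)).ne'
  have h2 : √f ≠ 0 := (Real.sqrt_pos.2 hf).ne'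
  have h3 : √(8 * μ) ≠ 0 := (Real.sqrt_pos.2 (by positivity)).ne'
  simp only [toQ, ofPQ, mul_smul_comm, qi_mul_qi_mul, smul_sub, smul_add, smul_neg, smul_smul]
  match_scalars <;> field_simp <;> norm_num

theorem ofPQ_toP_toQ (hμ : 0 < μ) (hM : 0 < M) (hf : 0 < f) (x : ℍ × ℍ) :
    ofPQ μ M f (toP μ M f x) (toQ μ M f x) = x := by
  have h1 : √(μ * M) ≠ 0 := (Real.sqrt_pos.2 (by positivity)).ne'
  have h2 : √f ≠ 0 := (Real.sqrt_pos.2 hf).ne'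
  have h3 : √(8 * μ) ≠ 0 := (Real.sqrt_pos.2 (by positivity)).ne'
  ext1
  · simp only [toP, toQ, ofPQ]
    match_scalars <;> field_simp <;> norm_num
  · simp only [toP, toQ, ofPQ, ← smul_sub]
    rw [show √f • x.1 - (√(8 * μ))⁻¹ • (qi * x.2) - (√f • x.1 + (√(8 * μ))⁻¹ • (qi * x.2)) =
      (-2 * (√(8 * μ))⁻¹) • (qi * x.2) by match_scalars <;> ring]
    simp only [mul_smul_comm, qi_mul_qi_mul, smul_neg, smul_smul]
    match_scalars
    field_simp

/-- In the coordinates `toP` and `toQ` the regularized level is the product of the unit spheres. -/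
theorem mem_regularizedLevel_iff (hμ : 0 < μ) (hM : 0 < M) (hf : 0 < f) (x : ℍ × ℍ) :
    x ∈ regularizedLevel μ M f ↔ ‖toP μ M f x‖ = 1 ∧ ‖toQ μ M f x‖ = 1 := by
  have hm : 0 < μ * M := by positivity
  have hc : 0 < √f * (√(8 * μ))⁻¹ := by positivity
  have e0 : ‖(√(8 * μ))⁻¹ • (qi * x.2)‖ ^ 2 = ‖x.2‖ ^ 2 / (8 * μ) := by
    rw [norm_smul, norm_mul, norm_qi, one_mul, mul_pow, Real.norm_eq_abs, sq_abs, inv_pow,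
      Real.sq_sqrt (by positivity)]
    field_simp
  have e0' : ‖√f • x.1‖ ^ 2 = f * ‖x.1‖ ^ 2 := by
    rw [norm_smul, mul_pow, Real.norm_eq_abs, sq_abs, Real.sq_sqrt hf.le]
  have e0'' : inner ℝ (√f • x.1) ((√(8 * μ))⁻¹ • (qi * x.2)) = √f * (√(8 * μ))⁻¹ * BL x := by
    rw [real_inner_smul_left, real_inner_smul_right, BL_eq_inner, mul_assoc]
  have e3 (y : ℍ) : ‖(√(μ * M))⁻¹ • y‖ ^ 2 = ‖y‖ ^ 2 / (μ * M) := by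
    rw [norm_smul, mul_pow, Real.norm_eq_abs, sq_abs, inv_pow, Real.sq_sqrt hm.le]
    field_simp
  -- The `BL` term enters `e1` and `e2` with opposite signs. With both norms equal to 1, adding the
  -- equations gives K = 0 and subtracting them gives `BL x = 0`.
  have e1 : ‖toP μ M f x‖ ^ 2 =
      (f * ‖x.1‖ ^ 2 - 2 * (√f * (√(8 * μ))⁻¹ * BL x) + ‖x.2‖ ^ 2 / (8 * μ)) / (μ * M) := by
    rw [toP, e3, norm_sub_sq_real, e0, e0', e0'']
  have e2 : ‖toQ μ M f x‖ ^ 2 =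
      (f * ‖x.1‖ ^ 2 + 2 * (√f * (√(8 * μ))⁻¹ * BL x) + ‖x.2‖ ^ 2 / (8 * μ)) / (μ * M) := by
    rw [toQ, e3, norm_add_sq_real, e0, e0', e0'']
  have e4 (y : ℍ) : ‖y‖ = 1 ↔ ‖y‖ ^ 2 = 1 := by
    rw [pow_eq_one_iff_of_nonneg (norm_nonneg y) two_ne_zero]
  rw [e4, e4, e1, e2, div_eq_one_iff_eq hm.ne', div_eq_one_iff_eq hm.ne']
  change (regularizedHamiltonian μ M f x = 0 ∧ BL x = 0) ↔ _
  rw [regularizedHamiltonian]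
  constructor
  · rintro ⟨h1, h2⟩
    rw [h2]
    constructor <;> linarith
  · rintro ⟨h1, h2⟩
    refine ⟨by linarith, ?_⟩
    have : √f * (√(8 * μ))⁻¹ * BL x = 0 := by linarith
    exact (mul_eq_zero.1 this).resolve_left hc.ne'

end Level

/-- The two-dimensional unit sphere. -/
abbrev S2 : Type := Metric.sphere (0 : EuclideanSpace ℝ (Fin 3)) 1

/-- The three-dimensional unit sphere. -/
abbrev S3 : Type := Metric.sphere (0 : EuclideanSpace ℝ (Fin 4)) 1

variable {μ M f : ℝ}

/-! ### Orbits and the projection. -/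

section Orbits

theorem norm_toP (hμ : 0 < μ) (hM : 0 < M) (hf : 0 < f) (x : regularizedLevel μ M f) :
    ‖toP μ M f x‖ = 1 := ((mem_regularizedLevel_iff hμ hM hf x).1 x.2).1

theorem norm_toQ (hμ : 0 < μ) (hM : 0 < M) (hf : 0 < f) (x : regularizedLevel μ M f) :
    ‖toQ μ M f x‖ = 1 := ((mem_regularizedLevel_iff hμ hM hf x).1 x.2).2

theorem ofPQ_mem (hμ : 0 < μ) (hM : 0 < M) (hf : 0 < f) {p q : ℍ} (hp : ‖p‖ = 1) (hq : ‖q‖ = 1) :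
    ofPQ μ M f p q ∈ regularizedLevel μ M f := by
  rw [mem_regularizedLevel_iff hμ hM hf, toP_ofPQ hμ hM hf, toQ_ofPQ hμ hM hf]
  exact ⟨hp, hq⟩

theorem proj_eq_iff {x y : regularizedLevel μ M f} : proj μ M f x = proj μ M f y ↔
    ∃ c : Circle, y.1.1 = ((c : ℂ) : ℍ) * x.1.1 ∧ y.1.2 = ((c : ℂ) : ℍ) * x.1.2 := by
  have h : proj μ M f x = proj μ M f y ↔ y ∈ MulAction.orbit Circle x := by
    rw [eq_comm]
    exact Quotient.eq (r := MulAction.orbitRel Circle (regularizedLevel μ M f))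
  rw [h]
  constructor
  · rintro ⟨c, rfl⟩
    exact ⟨c, rfl, rfl⟩
  · rintro ⟨c, h1, h2⟩
    exact ⟨c, Subtype.ext (Prod.ext h1.symm h2.symm)⟩

theorem proj_surjective : Function.Surjective (proj μ M f) := Quotient.mk_surjective

theorem isQuotientMap_proj : IsQuotientMap (proj μ M f) := isQuotientMap_quotient_mk'

theorem continuous_proj : Continuous (proj μ M f) := isQuotientMap_proj.continuous

theorem isOpenMap_proj : IsOpenMap (proj μ M f) := by
  have : ContinuousConstSMul Circle (regularizedLevel μ M f) := by
    refine ⟨fun c => ?_⟩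
    refine Continuous.subtype_mk (f := fun x : regularizedLevel μ M f =>
      (((c : ℂ) : ℍ) * x.1.1, ((c : ℂ) : ℍ) * x.1.2)) ?_ _
    fun_prop
  exact isOpenMap_quotient_mk'_mul

end Orbits

/-! ### The orbit map to S² × S³, its sections and the homeomorphism. -/

section Spheres

/-- The regularized level as a product of spheres. -/
noncomputable def levelHomeomorph (hμ : 0 < μ) (hM : 0 < M) (hf : 0 < f) :
    regularizedLevel μ M f ≃ₜ S3 × S3 where
  toFun x := (⟨e4 (toP μ M f x), by simp [norm_toP hμ hM hf x]⟩,
    ⟨e4 (toQ μ M f x), by simp [norm_toQ hμ hM hf x]⟩)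
  invFun y := ⟨ofPQ μ M f (e4.symm y.1) (e4.symm y.2), ofPQ_mem hμ hM hf (by simp) (by simp)⟩
  left_inv x := Subtype.ext (by
    simp only [LinearIsometryEquiv.symm_apply_apply]
    exact ofPQ_toP_toQ hμ hM hf x)
  right_inv y := by
    ext1 <;> ext1 <;> simp [toP_ofPQ hμ hM hf, toQ_ofPQ hμ hM hf]
  continuous_toFun := by
    have h1 := (contDiff_toP μ M f).continuous
    have h2 := (contDiff_toQ μ M f).continuous
    refine Continuous.prodMk (Continuous.subtype_mk ?_ _) (Continuous.subtype_mk ?_ _)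
    · exact e4.continuous.comp (h1.comp continuous_subtype_val)
    · exact e4.continuous.comp (h2.comp continuous_subtype_val)
  continuous_invFun := by
    have h1 := (contDiff_ofPQ μ M f).continuous
    refine Continuous.subtype_mk (h1.comp (g := fun x : ℍ × ℍ => ofPQ μ M f x.1 x.2)
      (f := fun y : S3 × S3 => (e4.symm y.1, e4.symm y.2)) ?_) _
    exact (e4.symm.continuous.comp (continuous_subtype_val.comp continuous_fst)).prodMk
      (e4.symm.continuous.comp (continuous_subtype_val.comp continuous_snd))

/-- The orbit map from the regularized level to the product of spheres. -/
noncomputable def orbitMap (hμ : 0 < μ) (hM : 0 < M) (hf : 0 < f) (x : regularizedLevel μ M f) :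
    S2 × S3 :=
  (⟨toVec (star (toP μ M f x) * qi * toP μ M f x), by
      simp [norm_toVec (star_conj_re _), norm_qi, norm_toP hμ hM hf x]⟩,
    ⟨e4 (star (toP μ M f x) * toQ μ M f x), by
      simp [norm_toP hμ hM hf x, norm_toQ hμ hM hf x]⟩)

/-- `exists_circle` applied to p and q finds the circle element, and `ofPQ`, which commutes with the
action, carries it back to (z, w). -/
theorem orbitMap_eq_iff (hμ : 0 < μ) (hM : 0 < M) (hf : 0 < f) {x y : regularizedLevel μ M f} :
    orbitMap hμ hM hf x = orbitMap hμ hM hf y ↔ proj μ M f x = proj μ M f y := by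
  have hx := ofPQ_toP_toQ hμ hM hf x.1
  have hy := ofPQ_toP_toQ hμ hM hf y.1
  rw [proj_eq_iff]
  constructor
  · intro h
    have h1 : toVec (star (toP μ M f x) * qi * toP μ M f x) =
        toVec (star (toP μ M f y) * qi * toP μ M f y) :=
      congrArg (fun z => (z.1 : EuclideanSpace ℝ (Fin 3))) h
    have h2 : e4 (star (toP μ M f x) * toQ μ M f x) = e4 (star (toP μ M f y) * toQ μ M f y) :=
      congrArg (fun z => (z.2 : EuclideanSpace ℝ (Fin 4))) h
    replace h1 := congrArg ofVec h1
    rw [ofVec_toVec (star_conj_re _), ofVec_toVec (star_conj_re _)] at h1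
    have hp : toP μ M f x ≠ 0 := by
      rw [← norm_ne_zero_iff, norm_toP hμ hM hf x]; exact one_ne_zero
    obtain ⟨c, h3, h4⟩ := exists_circle hp h1 (e4.injective h2)
    refine ⟨c, ?_⟩
    rw [h3, h4, ofPQ_circle, hx] at hy
    rw [← hy]
    exact ⟨rfl, rfl⟩
  · rintro ⟨c, h1, h2⟩
    have hxy : y.1 = (((c : ℂ) : ℍ) * x.1.1, ((c : ℂ) : ℍ) * x.1.2) := Prod.ext h1 h2
    have hc (a b : ℍ) : star (((c : ℂ) : ℍ) * a) * (((c : ℂ) : ℍ) * b) = star a * b := by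
      rw [star_mul, mul_assoc, ← mul_assoc _ _ b, star_circle_mul, one_mul]
    apply Prod.ext <;> apply Subtype.ext
    · change toVec _ = toVec _
      rw [hxy, toP_circle, mul_assoc _ qi, mul_assoc _ qi, ← mul_assoc qi, ← circle_mul_qi,
        mul_assoc _ qi, hc]
    · change e4 _ = e4 _
      rw [hxy, toP_circle, toQ_circle, hc]

/-- The ambient formula for the local sections of the orbit map. -/
noncomputable def sectionFormula (μ M f : ℝ) (x : ℍ × ℍ) (y : ℍ × ℍ) : ℍ × ℍ :=
  ofPQ μ M f (hopfLift (toP μ M f x) y.1) (hopfLift (toP μ M f x) y.1 * y.2)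

/-- The local section of the orbit map through `x`. -/
noncomputable def orbitSection (x : regularizedLevel μ M f) (y : S2 × S3) :
    regularizedLevel μ M f :=
  -- The default `x` occurs only where `hopfLift` degenerates, hence not near `orbitMap x`.
  open Classical in
  if h : sectionFormula μ M f x (ofVec y.1, e4.symm y.2) ∈ regularizedLevel μ M f then ⟨_, h⟩ else x

/-- The lift p of n is a unit, so q = p y₂ gives p̄ q = y₂ while p̄ i p = n. -/
theorem orbitMap_of_val (hμ : 0 < μ) (hM : 0 < M) (hf : 0 < f) (x : regularizedLevel μ M f)
    {y : S2 × S3} {z : regularizedLevel μ M f}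
    (hz : z.1 = sectionFormula μ M f x (ofVec y.1, e4.symm y.2))
    (hu : toP μ M f x - qi * toP μ M f x * ofVec y.1 ≠ 0) : orbitMap hμ hM hf z = y := by
  have hn : ‖ofVec y.1‖ = 1 := by rw [norm_ofVec]; simp
  have h1 := norm_hopfLift hu
  apply Prod.ext <;> apply Subtype.ext
  · change toVec _ = _
    rw [hz, sectionFormula, toP_ofPQ hμ hM hf, star_hopfLift (ofVec_re _) hn hu, toVec_ofVec]
  · change e4 _ = _
    rw [hz, sectionFormula, toP_ofPQ hμ hM hf, toQ_ofPQ hμ hM hf, ← mul_assoc,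
      star_mul_self_of_norm h1, one_mul, LinearIsometryEquiv.apply_symm_apply]

theorem sectionFormula_mem (hμ : 0 < μ) (hM : 0 < M) (hf : 0 < f) (x : regularizedLevel μ M f)
    {y : S2 × S3} (hu : toP μ M f x - qi * toP μ M f x * ofVec y.1 ≠ 0) :
    sectionFormula μ M f x (ofVec y.1, e4.symm y.2) ∈ regularizedLevel μ M f := by
  have h1 := norm_hopfLift hu
  exact ofPQ_mem hμ hM hf h1 (by rw [norm_mul, h1]; simp)

theorem orbitSection_val (hμ : 0 < μ) (hM : 0 < M) (hf : 0 < f) (x : regularizedLevel μ M f)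
    {y : S2 × S3} (hu : toP μ M f x - qi * toP μ M f x * ofVec y.1 ≠ 0) :
    (orbitSection x y).1 = sectionFormula μ M f x (ofVec y.1, e4.symm y.2) := by
  rw [orbitSection, dif_pos (sectionFormula_mem hμ hM hf x hu)]

theorem orbitMap_orbitSection_of_ne (hμ : 0 < μ) (hM : 0 < M) (hf : 0 < f)
    (x : regularizedLevel μ M f) {y : S2 × S3}
    (hu : toP μ M f x - qi * toP μ M f x * ofVec y.1 ≠ 0) :
    orbitMap hμ hM hf (orbitSection x y) = y :=
  orbitMap_of_val hμ hM hf x (orbitSection_val hμ hM hf x hu) hu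

theorem ofVec_orbitMap_fst (hμ : 0 < μ) (hM : 0 < M) (hf : 0 < f) (x : regularizedLevel μ M f) :
    ofVec (orbitMap hμ hM hf x).1 =
      (‖toP μ M f x‖ ^ 2)⁻¹ • (star (toP μ M f x) * qi * toP μ M f x) := by
  change ofVec (toVec _) = _
  rw [ofVec_toVec (star_conj_re _), norm_toP hμ hM hf x]
  simp

theorem sub_qi_mul_orbitMap_ne (hμ : 0 < μ) (hM : 0 < M) (hf : 0 < f)
    (x : regularizedLevel μ M f) :
    toP μ M f x - qi * toP μ M f x * ofVec (orbitMap hμ hM hf x).1 ≠ 0 := by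
  have hp : toP μ M f x ≠ 0 := by
    rw [← norm_ne_zero_iff, norm_toP hμ hM hf x]; exact one_ne_zero
  rw [ofVec_orbitMap_fst, sub_qi_mul_hopf hp]
  exact smul_ne_zero two_ne_zero hp

theorem eventually_orbitSection_ne (hμ : 0 < μ) (hM : 0 < M) (hf : 0 < f)
    (x : regularizedLevel μ M f) : ∀ᶠ y : S2 × S3 in 𝓝 (orbitMap hμ hM hf x),
      toP μ M f x - qi * toP μ M f x * ofVec y.1 ≠ 0 := by
  have h1 : Continuous (fun y : S2 × S3 => toP μ M f x - qi * toP μ M f x * ofVec y.1) := by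
    fun_prop
  exact h1.continuousAt.eventually_ne (sub_qi_mul_orbitMap_ne hμ hM hf x)

theorem orbitSection_orbitMap (hμ : 0 < μ) (hM : 0 < M) (hf : 0 < f)
    (x : regularizedLevel μ M f) : orbitSection x (orbitMap hμ hM hf x) = x := by
  have hp : toP μ M f x ≠ 0 := by
    rw [← norm_ne_zero_iff, norm_toP hμ hM hf x]; exact one_ne_zero
  apply Subtype.ext
  rw [orbitSection_val hμ hM hf x (sub_qi_mul_orbitMap_ne hμ hM hf x), sectionFormula,
    ofVec_orbitMap_fst, hopfLift_hopf hp, norm_toP hμ hM hf x, inv_one, one_smul]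
  change ofPQ μ M f (toP μ M f x) (toP μ M f x * e4.symm (e4 _)) = _
  rw [LinearIsometryEquiv.symm_apply_apply, ← mul_assoc,
    mul_star_self_of_norm (norm_toP hμ hM hf x), one_mul, ofPQ_toP_toQ hμ hM hf]

theorem orbitMap_surjective (hμ : 0 < μ) (hM : 0 < M) (hf : 0 < f) :
    Function.Surjective (orbitMap (M := M) hμ hM hf) := by
  intro y
  have hn : ‖ofVec y.1‖ = 1 := by rw [norm_ofVec]; simp
  -- The base point must depend on `y`: for a fixed nonzero x, `hopfLift x` degenerates at the
  -- antipode of the Hopf image of x.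
  obtain ⟨p, hp, hpn⟩ : ∃ p : ℍ, ‖p‖ = 1 ∧ star p * qi * p = ofVec y.1 := by
    obtain ⟨x, hx⟩ := exists_sub_qi_mul_ne (ofVec y.1)
    exact ⟨_, norm_hopfLift hx, star_hopfLift (ofVec_re _) hn hx⟩
  refine ⟨⟨ofPQ μ M f p (p * e4.symm y.2), ofPQ_mem hμ hM hf hp (by rw [norm_mul, hp]; simp)⟩, ?_⟩
  apply Prod.ext <;> apply Subtype.ext
  · change toVec _ = _
    rw [toP_ofPQ hμ hM hf, hpn, toVec_ofVec]
  · change e4 _ = _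
    rw [toP_ofPQ hμ hM hf, toQ_ofPQ hμ hM hf, ← mul_assoc,
      star_mul_self_of_norm hp, one_mul, LinearIsometryEquiv.apply_symm_apply]

theorem continuous_orbitMap (hμ : 0 < μ) (hM : 0 < M) (hf : 0 < f) :
    Continuous (orbitMap (M := M) hμ hM hf) := by
  have h1 : Continuous fun x : regularizedLevel μ M f => toP μ M f x :=
    (contDiff_toP μ M f).continuous.comp continuous_subtype_val
  have h2 : Continuous fun x : regularizedLevel μ M f => toQ μ M f x :=
    (contDiff_toQ μ M f).continuous.comp continuous_subtype_val
  refine Continuous.prodMk (Continuous.subtype_mk ?_ _) (Continuous.subtype_mk ?_ _)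
  · exact toVec.continuous.comp ((h1.star.mul continuous_const).mul h1)
  · exact e4.continuous.comp (h1.star.mul h2)

theorem compactSpace_level (hμ : 0 < μ) (hM : 0 < M) (hf : 0 < f) :
    CompactSpace (regularizedLevel μ M f) :=
  (levelHomeomorph hμ hM hf).symm.compactSpace

/-- The map from the orbit space to the product of spheres induced by the orbit map. -/
noncomputable def quotientEquiv (hμ : 0 < μ) (hM : 0 < M) (hf : 0 < f) :
    Compactification μ M f ≃ S2 × S3 :=
  Equiv.ofBijective (Quotient.lift (orbitMap hμ hM hf) fun _ _ h =>
      (orbitMap_eq_iff hμ hM hf).2 (Quotient.sound h)) (by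
    constructor
    · intro a b h
      obtain ⟨x, rfl⟩ := proj_surjective a
      obtain ⟨y, rfl⟩ := proj_surjective b
      exact (orbitMap_eq_iff hμ hM hf).1 h
    · intro y
      obtain ⟨x, rfl⟩ := orbitMap_surjective hμ hM hf y
      exact ⟨proj μ M f x, rfl⟩)

theorem compactSpace_compactification (hμ : 0 < μ) (hM : 0 < M) (hf : 0 < f) :
    CompactSpace (Compactification μ M f) := by
  have := compactSpace_level hμ hM hf
  exact Quotient.compactSpace

/-- The orbit space is homeomorphic to the product of spheres. -/
noncomputable def quotientHomeomorph (hμ : 0 < μ) (hM : 0 < M) (hf : 0 < f) :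
    Compactification μ M f ≃ₜ S2 × S3 :=
  haveI := compactSpace_compactification hμ hM hf
  Continuous.homeoOfEquivCompactToT2 (f := quotientEquiv hμ hM hf)
    (isQuotientMap_proj.continuous_iff.2 (continuous_orbitMap hμ hM hf))

theorem quotientHomeomorph_proj (hμ : 0 < μ) (hM : 0 < M) (hf : 0 < f)
    (x : regularizedLevel μ M f) :
    quotientHomeomorph hμ hM hf (proj μ M f x) = orbitMap hμ hM hf x := rfl

end Spheres

/-! ### Embedded submanifolds: smooth maps into them and a criterion. -/

section Submanifolds

variable {d : ℕ} {S : Set (ℍ × ℍ)} [ChartedSpace (EuclideanSpace ℝ (Fin d)) S]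

theorem IsSubmanifold.contMDiff_val (hS : IsSubmanifold d S) :
    ContMDiff (𝓡 d) 𝓘(ℝ, ℍ × ℍ) ∞ (Subtype.val : S → ℍ × ℍ) := hS.2.contMDiff

/-- A map into an embedded submanifold is smooth if it is smooth as a map into the ambient space. -/
theorem IsSubmanifold.contMDiffAt_of_val (hS : IsSubmanifold d S) {F H X : Type*}
    [NormedAddCommGroup F] [NormedSpace ℝ F] [TopologicalSpace H] {I : ModelWithCorners ℝ F H}
    [TopologicalSpace X] [ChartedSpace H X] {g : X → S} {x : X}
    (hg : ContMDiffAt I 𝓘(ℝ, ℍ × ℍ) ∞ (fun y => (g y).1) x) : ContMDiffAt I (𝓡 d) ∞ g x :=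
  (ContMDiffAt.iff_comp_isImmersionAt (hS.2.isImmersion.isImmersionAt (g x))).2
    ⟨IsInducing.subtypeVal.continuousAt_iff.2 hg.continuousAt, hg⟩

/-- A subset that is homeomorphic to a manifold by means of a smooth parametrization with local
smooth retractions is an embedded submanifold. -/
theorem isSubmanifold_transport {S : Set (ℍ × ℍ)} {E H Y : Type*} [NormedAddCommGroup E]
    [NormedSpace ℝ E] [TopologicalSpace H] {I : ModelWithCorners ℝ E H} [I.Boundaryless]
    [TopologicalSpace Y] [ChartedSpace H Y] [IsManifold I ∞ Y] (k : ℕ) (hdk : d + k = 8)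
    (L : E ≃L[ℝ] EuclideanSpace ℝ (Fin d)) (h : S ≃ₜ Y)
    {j : Y → ℍ × ℍ} (hj : ContMDiff I 𝓘(ℝ, ℍ × ℍ) ∞ j) (hjh : ∀ x, j (h x) = x.1)
    (r : S → ℍ × ℍ → Y) (hr : ∀ x : S, ∀ᶠ c in 𝓝 x.1, ContMDiffAt 𝓘(ℝ, ℍ × ℍ) I ∞ (r x) c)
    (hrh : ∀ x : S, ∀ᶠ y in 𝓝 x, r x y.1 = h y) :
    letI := transportChartedSpace I h L
    IsSubmanifold d S := by
  let _ := transportChartedSpace I h L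
  have hM := isManifold_transport I h L
  refine ⟨hM, ⟨?_, IsEmbedding.subtypeVal⟩⟩
  have key : Manifold.IsImmersionOfComplement (EuclideanSpace ℝ (Fin k)) (𝓡 d) 𝓘(ℝ, ℍ × ℍ) ∞
      (Subtype.val : S → ℍ × ℍ) := by
    intro x
    -- The ambient retraction `r x` followed by `h.symm` is a local left inverse of the inclusion;
    -- `k` is the codimension in the 8-dimensional ambient space.
    refine isImmersionAtOfComplement_of_leftInverse (g := fun c => h.symm (r x c))
      (EuclideanSpace ℝ (Fin k)) ?_ ?_ ?_ ?_
    · rw [Module.finrank_prod, Quaternion.finrank_eq_four, finrank_euclideanSpace_fin,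
        finrank_euclideanSpace_fin, hdk]
    · have h1 : ContMDiff (𝓡 d) 𝓘(ℝ, ℍ × ℍ) ∞ fun y => j (h y) :=
        hj.comp (contMDiff_transport I h L)
      have h2 : (Subtype.val : S → ℍ × ℍ) = fun y => j (h y) := funext fun y => (hjh y).symm
      rw [h2]
      exact Eventually.of_forall fun y => h1 y
    · filter_upwards [hr x] with c hc
      exact (contMDiff_transport_symm I h L _).comp c hc
    · filter_upwards [hrh x] with y hy
      rw [hy, h.symm_apply_apply]
  exact key.isImmersion

end Submanifolds

/-! ### Radial projection to the sphere. -/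

section Normalize

variable {n : ℕ}

/-- The radial projection to the unit sphere, with a default value at the origin. -/
noncomputable def normalize (a : Metric.sphere (0 : EuclideanSpace ℝ (Fin (n + 1))) 1)
    (v : EuclideanSpace ℝ (Fin (n + 1))) : Metric.sphere (0 : EuclideanSpace ℝ (Fin (n + 1))) 1 :=
  open Classical in
  if h : v = 0 then a else ⟨‖v‖⁻¹ • v, by
    rw [mem_sphere_zero_iff_norm, norm_smul, norm_inv, norm_norm,
      inv_mul_cancel₀ (norm_ne_zero_iff.2 h)]⟩

theorem coe_normalize (a : Metric.sphere (0 : EuclideanSpace ℝ (Fin (n + 1))) 1)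
    {v : EuclideanSpace ℝ (Fin (n + 1))} (hv : v ≠ 0) :
    (normalize a v : EuclideanSpace ℝ (Fin (n + 1))) = ‖v‖⁻¹ • v := by
  rw [normalize, dif_neg hv]

theorem normalize_coe (a v : Metric.sphere (0 : EuclideanSpace ℝ (Fin (n + 1))) 1) :
    normalize a v = v := by
  have hv : ‖(v : EuclideanSpace ℝ (Fin (n + 1)))‖ = 1 := norm_eq_of_mem_sphere v
  apply Subtype.ext
  rw [coe_normalize a (by rw [← norm_ne_zero_iff, hv]; exact one_ne_zero), hv, inv_one, one_smul]

theorem contMDiffAt_normalize (a : Metric.sphere (0 : EuclideanSpace ℝ (Fin (n + 1))) 1)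
    {v : EuclideanSpace ℝ (Fin (n + 1))} (hv : v ≠ 0) :
    ContMDiffAt 𝓘(ℝ, EuclideanSpace ℝ (Fin (n + 1))) (𝓡 n) ∞ (normalize a) v := by
  have := Fact.mk (@finrank_euclideanSpace_fin ℝ _ (n + 1))
  apply contMDiffAt_sphere_of_coe
  have h1 : ContDiffAt ℝ ∞ (fun v : EuclideanSpace ℝ (Fin (n + 1)) => ‖v‖⁻¹ • v) v :=
    ((contDiffAt_norm ℝ hv).inv (norm_ne_zero_iff.2 hv)).smul contDiffAt_id
  refine h1.contMDiffAt.congr_of_eventuallyEq ?_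
  filter_upwards [isOpen_ne.mem_nhds hv] with w hw
  exact coe_normalize a hw

theorem contMDiff_coe_sphere_fin : ContMDiff (𝓡 n) 𝓘(ℝ, EuclideanSpace ℝ (Fin (n + 1))) ∞
    (Subtype.val : Metric.sphere (0 : EuclideanSpace ℝ (Fin (n + 1))) 1 → _) := by
  have := Fact.mk (@finrank_euclideanSpace_fin ℝ _ (n + 1))
  exact contMDiff_coe_sphere

theorem contMDiffAt_sphere_of_coe_fin {F H X : Type*} [NormedAddCommGroup F] [NormedSpace ℝ F]
    [TopologicalSpace H] {I : ModelWithCorners ℝ F H} [TopologicalSpace X] [ChartedSpace H X]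
    {f : X → Metric.sphere (0 : EuclideanSpace ℝ (Fin (n + 1))) 1} {x : X}
    (hf : ContMDiffAt I 𝓘(ℝ, EuclideanSpace ℝ (Fin (n + 1))) ∞
      (fun y => (f y : EuclideanSpace ℝ (Fin (n + 1)))) x) : ContMDiffAt I (𝓡 n) ∞ f x := by
  have := Fact.mk (@finrank_euclideanSpace_fin ℝ _ (n + 1))
  exact contMDiffAt_sphere_of_coe hf

instance isManifold_sphere_fin :
    IsManifold (𝓡 n) ∞ (Metric.sphere (0 : EuclideanSpace ℝ (Fin (n + 1))) 1) :=
  IsManifold.of_le (n := ω) le_top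

end Normalize

variable {μ M f : ℝ}

/-! ### N_f as a submanifold of dimension 6. -/

section LevelManifold

/-- The linear isomorphism of the model spaces for the regularized level. -/
noncomputable def levelModel :
    (EuclideanSpace ℝ (Fin 3) × EuclideanSpace ℝ (Fin 3)) ≃L[ℝ] EuclideanSpace ℝ (Fin 6) :=
  ContinuousLinearEquiv.ofFinrankEq (by simp)

/-- The manifold structure of the regularized level. -/
@[reducible] noncomputable def levelChartedSpace (hμ : 0 < μ) (hM : 0 < M) (hf : 0 < f) :
    ChartedSpace (EuclideanSpace ℝ (Fin 6)) (regularizedLevel μ M f) :=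
  transportChartedSpace ((𝓡 3).prod (𝓡 3)) (levelHomeomorph hμ hM hf) levelModel

theorem contMDiff_prod_coe {m n : ℕ} : ContMDiff ((𝓡 m).prod (𝓡 n))
    𝓘(ℝ, EuclideanSpace ℝ (Fin (m + 1)) × EuclideanSpace ℝ (Fin (n + 1))) ∞
    (fun y : Metric.sphere (0 : EuclideanSpace ℝ (Fin (m + 1))) 1 ×
      Metric.sphere (0 : EuclideanSpace ℝ (Fin (n + 1))) 1 =>
      ((y.1 : EuclideanSpace ℝ (Fin (m + 1))), (y.2 : EuclideanSpace ℝ (Fin (n + 1))))) :=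
  (contMDiff_coe_sphere_fin.comp contMDiff_fst).prodMk_space
    (contMDiff_coe_sphere_fin.comp contMDiff_snd)

/-- Normalizing p and q separately retracts a neighbourhood of each point of the level onto S³ × S³.
-/
theorem isSubmanifold_level (hμ : 0 < μ) (hM : 0 < M) (hf : 0 < f) :
    letI := levelChartedSpace hμ hM hf
    IsSubmanifold 6 (regularizedLevel μ M f) := by
  have h0 (p : S3) : (p : EuclideanSpace ℝ (Fin 4)) ≠ 0 := ne_zero_of_mem_unit_sphere p
  have hP : ContDiff ℝ ∞ fun c : ℍ × ℍ => e4 (toP μ M f c) :=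
    e4.contDiff.comp (contDiff_toP μ M f)
  have hQ : ContDiff ℝ ∞ fun c : ℍ × ℍ => e4 (toQ μ M f c) :=
    e4.contDiff.comp (contDiff_toQ μ M f)
  refine isSubmanifold_transport 2 rfl levelModel (levelHomeomorph hμ hM hf)
    (j := fun y => ofPQ μ M f (e4.symm y.1) (e4.symm y.2)) ?_ ?_
    (fun x c => (normalize (levelHomeomorph hμ hM hf x).1 (e4 (toP μ M f c)),
      normalize (levelHomeomorph hμ hM hf x).2 (e4 (toQ μ M f c)))) ?_ ?_
  · have h1 : ContDiff ℝ ∞ fun y : EuclideanSpace ℝ (Fin 4) × EuclideanSpace ℝ (Fin 4) =>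
        ofPQ μ M f (e4.symm y.1) (e4.symm y.2) :=
      (contDiff_ofPQ μ M f).comp ((e4.symm.contDiff.comp contDiff_fst).prodMk
        (e4.symm.contDiff.comp contDiff_snd))
    exact h1.contMDiff.comp contMDiff_prod_coe
  · intro x
    exact congrArg Subtype.val ((levelHomeomorph hμ hM hf).symm_apply_apply x)
  · intro x
    have h1 : e4 (toP μ M f x.1) ≠ 0 := h0 (levelHomeomorph hμ hM hf x).1
    have h2 : e4 (toQ μ M f x.1) ≠ 0 := h0 (levelHomeomorph hμ hM hf x).2
    filter_upwards [hP.continuous.continuousAt.eventually_ne h1,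
      hQ.continuous.continuousAt.eventually_ne h2] with c h3 h4
    exact ((contMDiffAt_normalize _ h3).comp c hP.contMDiff.contMDiffAt).prodMk
      ((contMDiffAt_normalize _ h4).comp c hQ.contMDiff.contMDiffAt)
  · intro x
    refine Eventually.of_forall fun y => Prod.ext ?_ ?_
    · exact normalize_coe _ (levelHomeomorph hμ hM hf y).1
    · exact normalize_coe _ (levelHomeomorph hμ hM hf y).2

end LevelManifold

/-! ### S_f as a submanifold of dimension 5. -/

section EnergyManifold

/-- The distance from the origin of the points of the energy surface with momentum `v`. -/
noncomputable def radius (μ M f : ℝ) (v : EuclideanSpace ℝ (Fin 3)) : ℝ :=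
  μ * M / (‖v‖ ^ 2 / (2 * μ) + f)

theorem radius_pos (hμ : 0 < μ) (hM : 0 < M) (hf : 0 < f) (v : EuclideanSpace ℝ (Fin 3)) :
    0 < radius μ M f v := by
  unfold radius; positivity

theorem contDiff_radius (hμ : 0 < μ) (hf : 0 < f) : ContDiff ℝ ∞ (radius μ M f) := by
  unfold radius
  refine contDiff_const.div (((contDiff_norm_sq ℝ).div_const _).add contDiff_const) fun v => ?_
  positivity

/-- The energy equation reads μM/|Q| = |P|²/(2μ) + f, and the right side is positive since f > 0. So
only the direction of Q and the momentum P remain free, and both are unrestricted. -/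
theorem norm_fst_of_mem (hμ : 0 < μ) (hf : 0 < f) {x : ℍ × ℍ}
    (hx : x ∈ energySurface μ M f) : ‖x.1‖ = radius μ M f (toVec x.2) := by
  obtain ⟨-, h2, h3, h4⟩ := hx
  have h5 : ‖x.1‖ ≠ 0 := norm_ne_zero_iff.2 h3
  have h6 : 0 < ‖x.2‖ ^ 2 / (2 * μ) + f := by positivity
  rw [radius, norm_toVec h2, eq_div_iff h6.ne']
  rw [keplerHamiltonian] at h4
  have h7 : ‖x.2‖ ^ 2 / (2 * μ) + f = μ * M / ‖x.1‖ := by linarith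
  rw [h7]
  field_simp

theorem parametrization_mem (hμ : 0 < μ) (hM : 0 < M) (hf : 0 < f)
    (n : S2) (v : EuclideanSpace ℝ (Fin 3)) :
    (radius μ M f v • ofVec n, ofVec v) ∈ energySurface μ M f := by
  have hr := radius_pos hμ hM hf v
  have hn : ‖ofVec n‖ = 1 := by rw [norm_ofVec]; simp
  refine ⟨?_, ofVec_re v, smul_ne_zero hr.ne' ?_, ?_⟩
  · simp [ofVec_re]
  · rw [← norm_ne_zero_iff, hn]; exact one_ne_zero
  · rw [keplerHamiltonian, norm_smul, hn, norm_ofVec, Real.norm_of_nonneg hr.le, mul_one, radius]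
    have h6 : 0 < ‖v‖ ^ 2 / (2 * μ) + f := by positivity
    have h7 : 0 < μ * M := by positivity
    rw [div_div_cancel₀ h7.ne']
    ring

/-- The energy surface as the product of the sphere of directions and the space of momenta. -/
noncomputable def energyHomeomorph (hμ : 0 < μ) (hM : 0 < M) (hf : 0 < f) :
    energySurface μ M f ≃ₜ S2 × EuclideanSpace ℝ (Fin 3) where
  toFun x := (⟨‖x.1.1‖⁻¹ • toVec x.1.1, by
    rw [mem_sphere_zero_iff_norm, norm_smul, norm_inv, norm_norm, norm_toVec x.2.1,
      inv_mul_cancel₀ (norm_ne_zero_iff.2 x.2.2.2.1)]⟩, toVec x.1.2)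
  invFun y := ⟨_, parametrization_mem hμ hM hf y.1 y.2⟩
  left_inv x := by
    apply Subtype.ext
    apply Prod.ext
    · change radius μ M f (toVec x.1.2) • ofVec (‖x.1.1‖⁻¹ • toVec x.1.1) = x.1.1
      rw [← norm_fst_of_mem hμ hf x.2, map_smul, ofVec_toVec x.2.1, smul_smul,
        mul_inv_cancel₀ (norm_ne_zero_iff.2 x.2.2.2.1), one_smul]
    · exact ofVec_toVec x.2.2.1
  right_inv y := by
    have hr := radius_pos hμ hM hf y.2
    have hn : ‖ofVec y.1‖ = 1 := by rw [norm_ofVec]; simp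
    apply Prod.ext
    · apply Subtype.ext
      change ‖radius μ M f y.2 • ofVec y.1‖⁻¹ • toVec (radius μ M f y.2 • ofVec y.1) = _
      rw [norm_smul, hn, mul_one, Real.norm_of_nonneg hr.le, map_smul, toVec_ofVec, smul_smul,
        inv_mul_cancel₀ hr.ne', one_smul]
    · exact toVec_ofVec y.2
  continuous_toFun := by
    have h1 : Continuous fun x : energySurface μ M f => x.1.1 :=
      continuous_fst.comp continuous_subtype_val
    have h2 : Continuous fun x : energySurface μ M f => x.1.2 :=
      continuous_snd.comp continuous_subtype_val
    refine Continuous.prodMk (Continuous.subtype_mk ?_ _) (toVec.continuous.comp h2)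
    exact (h1.norm.inv₀ fun x => norm_ne_zero_iff.2 x.2.2.2.1).smul (toVec.continuous.comp h1)
  continuous_invFun := by
    have h1 := (contDiff_radius (M := M) hμ hf).continuous
    refine Continuous.subtype_mk ?_ _
    fun_prop

/-- The linear isomorphism of the model spaces for the product of the spheres. -/
noncomputable def prodModel :
    (EuclideanSpace ℝ (Fin 2) × EuclideanSpace ℝ (Fin 3)) ≃L[ℝ] EuclideanSpace ℝ (Fin 5) :=
  ContinuousLinearEquiv.ofFinrankEq (by simp)

/-- The manifold structure of the energy surface. -/
@[reducible] noncomputable def energyChartedSpace (hμ : 0 < μ) (hM : 0 < M) (hf : 0 < f) :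
    ChartedSpace (EuclideanSpace ℝ (Fin 5)) (energySurface μ M f) :=
  transportChartedSpace ((𝓡 2).prod (𝓡 3)) (energyHomeomorph hμ hM hf) prodModel

theorem contMDiff_energy_parametrization (hμ : 0 < μ) (hf : 0 < f) :
    ContMDiff ((𝓡 2).prod (𝓡 3)) 𝓘(ℝ, ℍ × ℍ) ∞
      (fun y : S2 × EuclideanSpace ℝ (Fin 3) =>
        (radius μ M f y.2 • ofVec y.1, ofVec y.2)) := by
  have h2 : ContMDiff ((𝓡 2).prod (𝓡 3)) (𝓡 3) ∞
      (fun y : S2 × EuclideanSpace ℝ (Fin 3) => (y.1 : EuclideanSpace ℝ (Fin 3))) :=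
    contMDiff_coe_sphere_fin.comp contMDiff_fst
  have h3 : ContMDiff ((𝓡 2).prod (𝓡 3)) (𝓡 3) ∞
      (fun y : S2 × EuclideanSpace ℝ (Fin 3) => y.2) := contMDiff_snd
  have h4 : ContMDiff ((𝓡 2).prod (𝓡 3)) 𝓘(ℝ, ℍ) ∞
      (fun y : S2 × EuclideanSpace ℝ (Fin 3) => ofVec y.1) := ofVec.contDiff.contMDiff.comp h2
  have h5 : ContMDiff ((𝓡 2).prod (𝓡 3)) 𝓘(ℝ, ℍ) ∞
      (fun y : S2 × EuclideanSpace ℝ (Fin 3) => ofVec y.2) := ofVec.contDiff.contMDiff.comp h3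
  have h6 : ContMDiff ((𝓡 2).prod (𝓡 3)) 𝓘(ℝ, ℝ) ∞
      (fun y : S2 × EuclideanSpace ℝ (Fin 3) => radius μ M f y.2) :=
    (contDiff_radius hμ hf).contMDiff.comp h3
  exact (h6.smul h4).prodMk_space h5

theorem isSubmanifold_energy (hμ : 0 < μ) (hM : 0 < M) (hf : 0 < f) :
    letI := energyChartedSpace hμ hM hf
    IsSubmanifold 5 (energySurface μ M f) := by
  refine isSubmanifold_transport 3 rfl prodModel (energyHomeomorph hμ hM hf)
    (j := fun y => (radius μ M f y.2 • ofVec y.1, ofVec y.2)) ?_ ?_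
    (fun x c => (normalize (energyHomeomorph hμ hM hf x).1 (toVec c.1), toVec c.2)) ?_ ?_
  · exact contMDiff_energy_parametrization hμ hf
  · intro x
    exact congrArg Subtype.val ((energyHomeomorph hμ hM hf).symm_apply_apply x)
  · intro x
    have h1 : toVec x.1.1 ≠ 0 := by
      rw [← norm_ne_zero_iff, norm_toVec x.2.1]
      exact norm_ne_zero_iff.2 x.2.2.2.1
    have h2 : ContDiff ℝ ∞ fun c : ℍ × ℍ => toVec c.1 := toVec.contDiff.comp contDiff_fst
    have h3 : ContDiff ℝ ∞ fun c : ℍ × ℍ => toVec c.2 := toVec.contDiff.comp contDiff_snd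
    filter_upwards [h2.continuous.continuousAt.eventually_ne h1] with c h4
    exact ((contMDiffAt_normalize _ h4).comp c h2.contMDiff.contMDiffAt).prodMk
      h3.contMDiff.contMDiffAt
  · intro x
    refine Eventually.of_forall fun y => Prod.ext ?_ rfl
    apply Subtype.ext
    change (normalize _ (toVec y.1.1) : EuclideanSpace ℝ (Fin 3)) = ‖y.1.1‖⁻¹ • toVec y.1.1
    rw [coe_normalize, norm_toVec y.2.1]
    rw [← norm_ne_zero_iff, norm_toVec y.2.1]
    exact norm_ne_zero_iff.2 y.2.2.2.1

end EnergyManifold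

variable {μ M f : ℝ}

theorem contDiff_star_quaternion : ContDiff ℝ ∞ (star : ℍ → ℍ) :=
  (LinearMap.toContinuousLinearMap
    ({ toFun := star, map_add' := star_add, map_smul' := fun r a => Quaternion.star_smul r a } :
      ℍ →ₗ[ℝ] ℍ)).contDiff

theorem contDiffAt_sectionFormula (x : ℍ × ℍ) {y : ℍ × ℍ}
    (hu : toP μ M f x - qi * toP μ M f x * y.1 ≠ 0) :
    ContDiffAt ℝ ∞ (sectionFormula μ M f x) y := by
  have h1 : ContDiffAt ℝ ∞ (fun y : ℍ × ℍ => hopfLift (toP μ M f x) y.1) y :=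
    (contDiffAt_hopfLift hu).comp y contDiffAt_fst
  exact (contDiff_ofPQ μ M f).contDiffAt.comp y (h1.prodMk (h1.mul contDiffAt_snd))

/-! ### Smoothness of the orbit map and its sections. -/

section OrbitMap

variable [ChartedSpace (EuclideanSpace ℝ (Fin 6)) (regularizedLevel μ M f)]

theorem contMDiff_orbitMap (hμ : 0 < μ) (hM : 0 < M) (hf : 0 < f)
    (hN : IsSubmanifold 6 (regularizedLevel μ M f)) :
    ContMDiff (𝓡 6) ((𝓡 2).prod (𝓡 3)) ∞ (orbitMap (M := M) hμ hM hf) := by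
  have hP := contDiff_toP μ M f
  have hQ := contDiff_toQ μ M f
  have hPs : ContDiff ℝ ∞ fun c => star (toP μ M f c) := contDiff_star_quaternion.comp hP
  have h1 : ContDiff ℝ ∞ fun c => toVec (star (toP μ M f c) * qi * toP μ M f c) :=
    toVec.contDiff.comp ((hPs.mul contDiff_const).mul hP)
  have h2 : ContDiff ℝ ∞ fun c => e4 (star (toP μ M f c) * toQ μ M f c) :=
    e4.contDiff.comp (hPs.mul hQ)
  intro x
  refine ContMDiffAt.prodMk ?_ ?_
  · exact contMDiffAt_sphere_of_coe_fin (h1.contMDiff.comp hN.contMDiff_val x)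
  · exact contMDiffAt_sphere_of_coe_fin (h2.contMDiff.comp hN.contMDiff_val x)

theorem contMDiffAt_orbitSection (hμ : 0 < μ) (hM : 0 < M) (hf : 0 < f)
    (hN : IsSubmanifold 6 (regularizedLevel μ M f)) (x : regularizedLevel μ M f) :
    ∀ᶠ y in 𝓝 (orbitMap hμ hM hf x),
      ContMDiffAt ((𝓡 2).prod (𝓡 3)) (𝓡 6) ∞ (orbitSection x) y := by
  filter_upwards [eventually_eventually_nhds.2 (eventually_orbitSection_ne hμ hM hf x)] with y hy
  apply hN.contMDiffAt_of_val
  have h2 : ContMDiff ((𝓡 2).prod (𝓡 3)) 𝓘(ℝ, ℍ) ∞ (fun y : S2 × S3 => ofVec y.1) :=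
    ofVec.contDiff.contMDiff.comp (contMDiff_coe_sphere_fin.comp contMDiff_fst)
  have h3 : ContMDiff ((𝓡 2).prod (𝓡 3)) 𝓘(ℝ, ℍ) ∞ (fun y : S2 × S3 => e4.symm y.2) :=
    e4.symm.contDiff.contMDiff.comp (contMDiff_coe_sphere_fin.comp contMDiff_snd)
  have h4 : ContMDiffAt ((𝓡 2).prod (𝓡 3)) 𝓘(ℝ, ℍ × ℍ) ∞
      (fun y : S2 × S3 => sectionFormula μ M f x (ofVec y.1, e4.symm y.2)) y :=
    (contDiffAt_sectionFormula (f := f) (y := (ofVec y.1, e4.symm y.2)) x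
      hy.self_of_nhds).contMDiffAt.comp y (h2.prodMk_space h3).contMDiffAt
  exact h4.congr_of_eventuallyEq (hy.mono fun z hz => orbitSection_val hμ hM hf x hz)

end OrbitMap

/-! ### The smooth quotient and its diffeomorphism with S² × S³. -/

section Quotient

/-- The manifold structure of the orbit space. -/
@[reducible] noncomputable def quotientChartedSpace (hμ : 0 < μ) (hM : 0 < M) (hf : 0 < f) :
    ChartedSpace (EuclideanSpace ℝ (Fin 5)) (Compactification μ M f) :=
  transportChartedSpace ((𝓡 2).prod (𝓡 3)) (quotientHomeomorph hμ hM hf) prodModel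

theorem isQuotientManifold_quotient
    [ChartedSpace (EuclideanSpace ℝ (Fin 6)) (regularizedLevel μ M f)]
    (hμ : 0 < μ) (hM : 0 < M) (hf : 0 < f) (hN : IsSubmanifold 6 (regularizedLevel μ M f)) :
    letI := quotientChartedSpace hμ hM hf
    IsQuotientManifold μ M f := by
  let _ := quotientChartedSpace hμ hM hf
  have hC : IsManifold (𝓡 5) ∞ (Compactification μ M f) :=
    isManifold_transport _ (quotientHomeomorph hμ hM hf) prodModel
  have hN' : IsManifold (𝓡 6) ∞ (regularizedLevel μ M f) := hN.1
  have hh : ContMDiff (𝓡 5) ((𝓡 2).prod (𝓡 3)) ∞ (quotientHomeomorph hμ hM hf) :=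
    contMDiff_transport _ (quotientHomeomorph hμ hM hf) prodModel
  have hh' : ContMDiff ((𝓡 2).prod (𝓡 3)) (𝓡 5) ∞ (quotientHomeomorph hμ hM hf).symm :=
    contMDiff_transport_symm _ (quotientHomeomorph hμ hM hf) prodModel
  have hp : proj μ M f = (quotientHomeomorph hμ hM hf).symm ∘ orbitMap hμ hM hf := by
    funext x
    exact ((quotientHomeomorph hμ hM hf).symm_apply_apply (proj μ M f x)).symm
  have key : Manifold.IsSubmersionOfComplement (EuclideanSpace ℝ (Fin 1)) (𝓡 6) (𝓡 5) ∞
      (proj μ M f) := by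
    intro x
    have ht : Tendsto (quotientHomeomorph hμ hM hf) (𝓝 (proj μ M f x))
        (𝓝 (orbitMap hμ hM hf x)) := (quotientHomeomorph hμ hM hf).continuous.continuousAt
    refine isSubmersionAtOfComplement_of_section
      (s := fun c => orbitSection x (quotientHomeomorph hμ hM hf c))
      (EuclideanSpace ℝ (Fin 1)) (by simp) ?_ ?_ ?_ ?_
    · rw [hp]
      exact Eventually.of_forall (hh'.comp (contMDiff_orbitMap hμ hM hf hN))
    · filter_upwards [ht.eventually (contMDiffAt_orbitSection hμ hM hf hN x)] with c hc
      exact hc.comp c (hh c)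
    · exact orbitSection_orbitMap hμ hM hf x
    · filter_upwards [ht.eventually (eventually_orbitSection_ne hμ hM hf x)] with c hc
      apply (quotientHomeomorph hμ hM hf).injective
      rw [quotientHomeomorph_proj, orbitMap_orbitSection_of_ne hμ hM hf x hc]
  exact ⟨hC, key.isSubmersion⟩

/-- A map from the orbit space is smooth at the orbit of `x` if its composition with the projection
is smooth at `x`. -/
theorem IsQuotientManifold.contMDiffAt_of_comp
    [ChartedSpace (EuclideanSpace ℝ (Fin 6)) (regularizedLevel μ M f)]
    [ChartedSpace (EuclideanSpace ℝ (Fin 5)) (Compactification μ M f)]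
    (hC : IsQuotientManifold μ M f) {F H X : Type*} [NormedAddCommGroup F] [NormedSpace ℝ F]
    [TopologicalSpace H] {I : ModelWithCorners ℝ F H} [TopologicalSpace X] [ChartedSpace H X]
    {g : Compactification μ M f → X} {x : regularizedLevel μ M f}
    (hg : ContMDiffAt (𝓡 6) I ∞ (fun y => g (proj μ M f y)) x) :
    ContMDiffAt (𝓡 5) I ∞ g (proj μ M f x) := by
  obtain ⟨s, hsx, hs, hs'⟩ := exists_section_of_isSubmersion hC.2 x
  have h1 : ContMDiffAt (𝓡 5) I ∞ (fun c => g (proj μ M f (s c))) (proj μ M f x) :=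
    ContMDiffAt.comp (g := fun y => g (proj μ M f y)) (proj μ M f x) (by rw [hsx]; exact hg) hs'
  exact h1.congr_of_eventuallyEq (hs.mono fun c hc => by simp only [hc])

/-- Smoothness is tested upstairs: one direction pulls back to `orbitMap` on the level, and the
inverse is locally the projection of `orbitSection`. No particular atlas enters. -/
theorem nonempty_diffeomorph
    [ChartedSpace (EuclideanSpace ℝ (Fin 6)) (regularizedLevel μ M f)]
    [ChartedSpace (EuclideanSpace ℝ (Fin 5)) (Compactification μ M f)]
    (hμ : 0 < μ) (hM : 0 < M) (hf : 0 < f) (hN : IsSubmanifold 6 (regularizedLevel μ M f))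
    (hC : IsQuotientManifold μ M f) :
    Nonempty (Compactification μ M f ≃ₘ⟮𝓡 5, (𝓡 2).prod (𝓡 3)⟯ (S2 × S3)) := by
  refine ⟨⟨(quotientHomeomorph hμ hM hf).toEquiv, ?_, ?_⟩⟩
  · intro c
    obtain ⟨x, rfl⟩ := proj_surjective c
    exact hC.contMDiffAt_of_comp (contMDiff_orbitMap hμ hM hf hN x)
  · intro y
    obtain ⟨x, rfl⟩ := orbitMap_surjective (M := M) hμ hM hf y
    have h1 := (hC.2.contMDiff (orbitSection x (orbitMap hμ hM hf x))).comp _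
      (contMDiffAt_orbitSection hμ hM hf hN x).self_of_nhds
    refine h1.congr_of_eventuallyEq ?_
    filter_upwards [eventually_orbitSection_ne hμ hM hf x] with y hy
    apply (quotientHomeomorph hμ hM hf).injective
    change (quotientHomeomorph hμ hM hf) ((quotientHomeomorph hμ hM hf).symm y) =
      orbitMap hμ hM hf (orbitSection x y)
    rw [Homeomorph.apply_symm_apply, orbitMap_orbitSection_of_ne hμ hM hf x hy]

end Quotient

variable {μ M f : ℝ}

/-! ### The Kustaanheimo–Stiefel mapping: energy, fibres and local lifts. -/

section KSMap

theorem norm_ksMap_fst (x : ℍ × ℍ) : ‖(ksMap x).1‖ = ‖x.1‖ ^ 2 := by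
  rw [ksMap, norm_star_conj, sq]

theorem norm_ksMap_snd {x : ℍ × ℍ} (hx : x.1 ≠ 0) : ‖(ksMap x).2‖ = ‖x.2‖ / (2 * ‖x.1‖) := by
  have h : ‖x.1‖ ≠ 0 := norm_ne_zero_iff.2 hx
  rw [ksMap, norm_smul, norm_star_conj, Real.norm_of_nonneg (by positivity)]
  field_simp

theorem ksMap_fst_ne_zero {x : ℍ × ℍ} (hx : x.1 ≠ 0) : (ksMap x).1 ≠ 0 := by
  rw [← norm_ne_zero_iff, norm_ksMap_fst]
  exact pow_ne_zero 2 (norm_ne_zero_iff.2 hx)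

/-- The Kustaanheimo-Stiefel mapping relates the regularized level and the energy surface. -/
theorem ksMap_mem_iff {x : ℍ × ℍ} (hx : x.1 ≠ 0) :
    ksMap x ∈ energySurface μ M f ↔ x ∈ regularizedLevel μ M f := by
  have h : ‖x.1‖ ≠ 0 := norm_ne_zero_iff.2 hx
  have h1 : (ksMap x).1.re = 0 := star_conj_re x.1
  have h2 : (ksMap x).2.re = (2 * ‖x.1‖ ^ 2)⁻¹ * BL x := Quaternion.re_smul _ _
  have h3 : (ksMap x).2.re = 0 ↔ BL x = 0 := by
    rw [h2, mul_eq_zero, or_iff_right]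
    positivity
  have h4 : keplerHamiltonian μ M (ksMap x) + f = 0 ↔ regularizedHamiltonian μ M f x = 0 := by
    -- This is the regularization: |Q| = |z|² and |P| = |w|/(2|z|), so the zero levels agree where z
    -- ≠ 0.
    have h5 : keplerHamiltonian μ M (ksMap x) + f =
        regularizedHamiltonian μ M f x / ‖x.1‖ ^ 2 := by
      rw [keplerHamiltonian, regularizedHamiltonian, norm_ksMap_fst, norm_ksMap_snd hx]
      have h6 : f * ‖x.1‖ ^ 2 / ‖x.1‖ ^ 2 = f := by field_simp
      linear_combination -h6
    rw [h5, div_eq_zero_iff, or_iff_left (pow_ne_zero 2 h)]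
  change _ ∧ _ ∧ _ ∧ _ ↔ _ ∧ _
  rw [h3, h4]
  exact ⟨fun h => ⟨h.2.2.2, h.2.1⟩, fun h => ⟨h1, h.2, ksMap_fst_ne_zero hx, h.1⟩⟩

/-- Equal Q forces equal |z|, so equal P forces equal z̄ i w; `exists_circle` then applies to z and
i w, and i is cancelled at the end. -/
theorem ksMap_eq_iff {x y : regularizedLevel μ M f} (hx : x.1.1 ≠ 0) (hy : y.1.1 ≠ 0) :
    ksMap x.1 = ksMap y.1 ↔ proj μ M f x = proj μ M f y := by
  rw [proj_eq_iff]
  constructor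
  · intro h
    have h1 : star x.1.1 * qi * x.1.1 = star y.1.1 * qi * y.1.1 := congrArg Prod.fst h
    have h2 : (2 * ‖x.1.1‖ ^ 2)⁻¹ • (star x.1.1 * qi * x.1.2) =
        (2 * ‖y.1.1‖ ^ 2)⁻¹ • (star y.1.1 * qi * y.1.2) := congrArg Prod.snd h
    have hn : ‖x.1.1‖ ^ 2 = ‖y.1.1‖ ^ 2 := by rw [← norm_ksMap_fst, h, norm_ksMap_fst]
    have hc : (2 * ‖y.1.1‖ ^ 2)⁻¹ ≠ 0 := by
      have := norm_ne_zero_iff.2 hy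
      positivity
    rw [hn] at h2
    replace h2 := smul_right_injective ℍ hc h2
    simp only [mul_assoc _ qi] at h2
    obtain ⟨c, h3, h4⟩ := exists_circle hx h1 h2
    refine ⟨c, h3, qi_mul_inj ?_⟩
    rw [h4, ← mul_assoc, circle_mul_qi, mul_assoc]
  · rintro ⟨c, h1, h2⟩
    have hc (a b : ℍ) : star (((c : ℂ) : ℍ) * a) * qi * (((c : ℂ) : ℍ) * b) = star a * qi * b := by
      rw [star_mul, mul_assoc (star a * _), ← mul_assoc qi, ← circle_mul_qi, mul_assoc (star a),
        mul_assoc ((c : ℂ) : ℍ), ← mul_assoc (star ((c : ℂ) : ℍ)), star_circle_mul, one_mul,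
        mul_assoc (star a)]
    rw [ksMap, ksMap, h1, h2, hc, hc, norm_mul, norm_circle, one_mul]

/-- The ambient formula for the local sections of the Kustaanheimo-Stiefel mapping. -/
noncomputable def ksLift (x : ℍ) (y : ℍ × ℍ) : ℍ × ℍ :=
  (√‖y.1‖ • hopfLift x (‖y.1‖⁻¹ • y.1),
    (-2 : ℝ) • (qi * (√‖y.1‖ • hopfLift x (‖y.1‖⁻¹ • y.1)) * y.2))

theorem norm_ksLift_fst {x : ℍ} {y : ℍ × ℍ} (hu : x - qi * x * (‖y.1‖⁻¹ • y.1) ≠ 0) :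
    ‖(ksLift x y).1‖ = √‖y.1‖ := by
  rw [ksLift, norm_smul, norm_hopfLift hu, mul_one, Real.norm_of_nonneg (Real.sqrt_nonneg _)]

theorem ksLift_fst_ne_zero {x : ℍ} {y : ℍ × ℍ} (hy : y.1 ≠ 0)
    (hu : x - qi * x * (‖y.1‖⁻¹ • y.1) ≠ 0) : (ksLift x y).1 ≠ 0 := by
  rw [← norm_ne_zero_iff, norm_ksLift_fst hu]
  exact (Real.sqrt_pos.2 (norm_pos_iff.2 hy)).ne'

/-- Once z̄ i z = Q, the choice w = -2 i z P solves z̄ i w = 2|z|² P because i² = -1. -/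
theorem ksMap_ksLift {x : ℍ} {y : ℍ × ℍ} (hy : y.1 ≠ 0) (hy' : y.1.re = 0)
    (hu : x - qi * x * (‖y.1‖⁻¹ • y.1) ≠ 0) : ksMap (ksLift x y) = y := by
  have hpos : 0 < ‖y.1‖ := norm_pos_iff.2 hy
  have hn : (‖y.1‖⁻¹ • y.1).re = 0 := by simp [hy']
  have hn' : ‖‖y.1‖⁻¹ • y.1‖ = 1 := by
    rw [norm_smul, norm_inv, norm_norm, inv_mul_cancel₀ hpos.ne']
  have hz : ‖(ksLift x y).1‖ ^ 2 = ‖y.1‖ := by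
    rw [norm_ksLift_fst hu, Real.sq_sqrt hpos.le]
  apply Prod.ext
  · change star (√‖y.1‖ • hopfLift x (‖y.1‖⁻¹ • y.1)) * qi *
      (√‖y.1‖ • hopfLift x (‖y.1‖⁻¹ • y.1)) = y.1
    rw [Quaternion.star_smul, smul_mul_assoc, smul_mul_assoc, mul_smul_comm,
      star_hopfLift hn hn' hu, smul_smul, smul_smul, Real.mul_self_sqrt hpos.le, mul_inv_cancel₀ hpos.ne', one_smul]
  · have h2 : (ksLift x y).2 = (-2 : ℝ) • (qi * ((ksLift x y).1 * y.2)) := by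
      rw [← mul_assoc]; rfl
    change (2 * ‖(ksLift x y).1‖ ^ 2)⁻¹ • (star (ksLift x y).1 * qi * (ksLift x y).2) = y.2
    rw [h2, mul_smul_comm, mul_assoc (star _), qi_mul_qi_mul, mul_neg, ← mul_assoc,
      star_mul_self_smul, Quaternion.coe_mul_eq_smul, hz, smul_neg, neg_smul, neg_neg, smul_smul,
      smul_smul]
    convert one_smul ℝ y.2
    field_simp

theorem normalized_ksMap_fst (x : ℍ × ℍ) :
    ‖(ksMap x).1‖⁻¹ • (ksMap x).1 = (‖x.1‖ ^ 2)⁻¹ • (star x.1 * qi * x.1) := by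
  rw [norm_ksMap_fst]; rfl

theorem sub_qi_mul_ksMap_ne {x : ℍ × ℍ} (hx : x.1 ≠ 0) :
    x.1 - qi * x.1 * (‖(ksMap x).1‖⁻¹ • (ksMap x).1) ≠ 0 := by
  rw [normalized_ksMap_fst, sub_qi_mul_hopf hx]
  exact smul_ne_zero two_ne_zero hx

theorem contDiffAt_ksLift {x : ℍ} {y : ℍ × ℍ} (hy : y.1 ≠ 0)
    (hu : x - qi * x * (‖y.1‖⁻¹ • y.1) ≠ 0) : ContDiffAt ℝ ∞ (ksLift x) y := by
  have hn : ‖y.1‖ ≠ 0 := norm_ne_zero_iff.2 hy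
  have h1 : ContDiffAt ℝ ∞ (fun y : ℍ × ℍ => ‖y.1‖) y := contDiffAt_fst.norm ℝ hy
  have h2 : ContDiffAt ℝ ∞ (fun y : ℍ × ℍ => ‖y.1‖⁻¹ • y.1) y := (h1.inv hn).smul contDiffAt_fst
  have h3 : ContDiffAt ℝ ∞ (fun y : ℍ × ℍ => √‖y.1‖ • hopfLift x (‖y.1‖⁻¹ • y.1)) y :=
    (h1.sqrt hn).smul (ContDiffAt.comp (g := hopfLift x) y (contDiffAt_hopfLift hu) h2)
  have h4 : ContDiffAt ℝ ∞
      (fun y : ℍ × ℍ => qi * (√‖y.1‖ • hopfLift x (‖y.1‖⁻¹ • y.1)) * y.2) y :=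
    (contDiffAt_const.mul h3).mul contDiffAt_snd
  exact h3.prodMk (h4.const_smul (-2 : ℝ))

theorem contDiffAt_ksMap {x : ℍ × ℍ} (hx : x.1 ≠ 0) : ContDiffAt ℝ ∞ ksMap x := by
  have hn : ‖x.1‖ ≠ 0 := norm_ne_zero_iff.2 hx
  have h1 : ContDiffAt ℝ ∞ (fun x : ℍ × ℍ => star x.1) x :=
    contDiff_star_quaternion.contDiffAt.comp x contDiffAt_fst
  have h2 : ContDiffAt ℝ ∞ (fun y : ℍ × ℍ => ‖y.1‖) x := contDiffAt_fst.norm ℝ hx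
  have h3 : ContDiffAt ℝ ∞ (fun y : ℍ × ℍ => star y.1 * qi) x := h1.mul contDiffAt_const
  exact (h3.mul contDiffAt_fst).prodMk
    (((contDiffAt_const.mul (h2.pow 2)).inv (by positivity)).smul (h3.mul contDiffAt_snd))

theorem eventually_ksLift_ne {x : ℍ} {y : ℍ × ℍ} (hy : y.1 ≠ 0)
    (hu : x - qi * x * (‖y.1‖⁻¹ • y.1) ≠ 0) :
    ∀ᶠ y' : ℍ × ℍ in 𝓝 y, x - qi * x * (‖y'.1‖⁻¹ • y'.1) ≠ 0 := by
  have h1 : ContinuousAt (fun y : ℍ × ℍ => x - qi * x * (‖y.1‖⁻¹ • y.1)) y :=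
    continuousAt_const.sub (continuousAt_const.mul
      ((continuousAt_fst.norm.inv₀ (norm_ne_zero_iff.2 hy)).smul continuousAt_fst))
  exact h1.eventually_ne hu

theorem exists_ksMap_eq (y : energySurface μ M f) :
    ∃ x : regularizedLevel μ M f, x.1.1 ≠ 0 ∧ ksMap x.1 = y.1 := by
  obtain ⟨x, hx⟩ := exists_sub_qi_mul_ne (‖y.1.1‖⁻¹ • y.1.1)
  have h1 := ksMap_ksLift y.2.2.2.1 y.2.1 hx
  have h2 := ksLift_fst_ne_zero y.2.2.2.1 hx
  exact ⟨⟨ksLift x y.1, (ksMap_mem_iff h2).1 (by rw [h1]; exact y.2)⟩, h2, h1⟩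

end KSMap

/-! ### S_f as a dense open part of the orbit space. -/

section Embedding

/-- A point of the regularized level over a point of the energy surface. -/
noncomputable def ksPreimage (y : energySurface μ M f) : regularizedLevel μ M f :=
  (exists_ksMap_eq y).choose

theorem ksPreimage_ne (y : energySurface μ M f) : (ksPreimage y).1.1 ≠ 0 :=
  (exists_ksMap_eq y).choose_spec.1

theorem ksMap_ksPreimage (y : energySurface μ M f) : ksMap (ksPreimage y).1 = y.1 :=
  (exists_ksMap_eq y).choose_spec.2

/-- The inverse of the Kustaanheimo-Stiefel mapping as a map to the orbit space. -/
noncomputable def ksInverse (μ M f : ℝ) (y : energySurface μ M f) : Compactification μ M f :=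
  proj μ M f (ksPreimage y)

/-- Makes the arbitrary choice in `ksPreimage` harmless: preimages of one point form a single orbit.
-/
theorem ksInverse_eq_iff (y : energySurface μ M f) {x : regularizedLevel μ M f}
    (hx : x.1.1 ≠ 0) : ksInverse μ M f y = proj μ M f x ↔ ksMap x.1 = y.1 := by
  rw [ksInverse, ← ksMap_eq_iff (ksPreimage_ne y) hx, ksMap_ksPreimage, eq_comm]

theorem ksInverse_injective : Function.Injective (ksInverse μ M f) := by
  intro y y' h
  have h1 := (ksInverse_eq_iff y (ksPreimage_ne y')).1 h
  rw [ksMap_ksPreimage] at h1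
  exact Subtype.ext h1.symm

theorem range_ksInverse : range (ksInverse μ M f) = proj μ M f '' {x | x.1.1 ≠ 0} := by
  apply Subset.antisymm
  · rintro _ ⟨y, rfl⟩
    exact ⟨ksPreimage y, ksPreimage_ne y, rfl⟩
  · rintro _ ⟨x, hx, rfl⟩
    exact ⟨⟨ksMap x.1, (ksMap_mem_iff hx).2 x.2⟩, (ksInverse_eq_iff _ hx).2 rfl⟩

theorem isOpen_range_ksInverse : IsOpen (range (ksInverse μ M f)) := by
  rw [range_ksInverse]
  refine isOpenMap_proj _ ?_
  exact isOpen_ne_fun (continuous_fst.comp continuous_subtype_val) continuous_const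

theorem dense_fst_ne_zero (hμ : 0 < μ) (hM : 0 < M) (hf : 0 < f) :
    Dense {x : regularizedLevel μ M f | x.1.1 ≠ 0} := by
  intro x
  by_cases hx : x.1.1 = 0
  swap
  · exact subset_closure hx
  have hK : ‖x.1.2‖ ^ 2 / (8 * μ) + f * ‖x.1.1‖ ^ 2 - μ * M = 0 := x.2.1
  rw [hx, norm_zero] at hK
  have hw : x.1.2 ≠ 0 := by
    intro h
    rw [h, norm_zero] at hK
    have : 0 < μ * M := by positivity
    norm_num at hK
    rcases hK with h | h <;> linarith
  -- Chosen so that f c² = 1/(8μ): along (c sin t · w, cos t · w) the quadratic part of K is then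
  -- constant by sin² + cos² = 1. Both entries are real multiples of w, so the cone condition
  -- follows from `star_conj_re`.
  set c : ℝ := (√(8 * μ * f))⁻¹ with hc
  have hc0 : 0 < c := by positivity
  have hc2 : c ^ 2 = (8 * μ * f)⁻¹ := by rw [hc, inv_pow, Real.sq_sqrt (by positivity)]
  have hmem (t : ℝ) : ((Real.sin t * c) • x.1.2, Real.cos t • x.1.2) ∈ regularizedLevel μ M f := by
    constructor
    · change _ / _ + _ - _ = 0
      simp only [norm_smul, mul_pow, Real.norm_eq_abs, sq_abs, hc2]
      have hs := Real.sin_sq_add_cos_sq t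
      have h1 : f * (8 * μ * f)⁻¹ = (8 * μ)⁻¹ := by field_simp
      rw [← hK]
      rw [show Real.cos t ^ 2 * ‖x.1.2‖ ^ 2 / (8 * μ) = Real.cos t ^ 2 * ‖x.1.2‖ ^ 2 * (8 * μ)⁻¹
        from div_eq_mul_inv _ _, div_eq_mul_inv]
      linear_combination (‖x.1.2‖ ^ 2 * (8 * μ)⁻¹) * hs +
        Real.sin t ^ 2 * ‖x.1.2‖ ^ 2 * h1
    · change (star ((Real.sin t * c) • x.1.2) * qi * (Real.cos t • x.1.2)).re = 0
      rw [Quaternion.star_smul, smul_mul_assoc, smul_mul_assoc, mul_smul_comm, Quaternion.re_smul,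
        Quaternion.re_smul, star_conj_re, smul_zero, smul_zero]
  set γ : ℝ → regularizedLevel μ M f := fun t => ⟨_, hmem t⟩
  have hγ : Continuous γ := by
    refine Continuous.subtype_mk ?_ _
    fun_prop
  have hγ0 : γ 0 = x := by
    apply Subtype.ext
    apply Prod.ext
    · change (Real.sin 0 * c) • x.1.2 = x.1.1
      simp [hx]
    · change Real.cos 0 • x.1.2 = x.1.2
      simp
  have ht : Tendsto γ (𝓝[>] 0) (𝓝 x) := by
    rw [← hγ0]
    exact hγ.continuousAt.tendsto.mono_left nhdsWithin_le_nhds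
  refine mem_closure_of_tendsto ht ?_
  filter_upwards [Ioo_mem_nhdsGT Real.pi_pos] with t ht
  exact smul_ne_zero (mul_pos (Real.sin_pos_of_mem_Ioo ht) hc0).ne' hw

theorem denseRange_ksInverse (hμ : 0 < μ) (hM : 0 < M) (hf : 0 < f) :
    DenseRange (ksInverse μ M f) := by
  rw [DenseRange, range_ksInverse]
  exact proj_surjective.denseRange.dense_image continuous_proj (dense_fst_ne_zero hμ hM hf)

variable [ChartedSpace (EuclideanSpace ℝ (Fin 6)) (regularizedLevel μ M f)]
  [ChartedSpace (EuclideanSpace ℝ (Fin 5)) (energySurface μ M f)]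
  [ChartedSpace (EuclideanSpace ℝ (Fin 5)) (Compactification μ M f)]

theorem contMDiff_ksInverse (hN : IsSubmanifold 6 (regularizedLevel μ M f))
    (hS : IsSubmanifold 5 (energySurface μ M f)) (hC : IsQuotientManifold μ M f) :
    ContMDiff (𝓡 5) (𝓡 5) ∞ (ksInverse μ M f) := by
  classical
  intro y
  set x := ksPreimage y with hx
  have hx0 : x.1.1 ≠ 0 := ksPreimage_ne y
  have hxy : ksMap x.1 = y.1 := ksMap_ksPreimage y
  have hu := sub_qi_mul_ksMap_ne hx0
  rw [hxy] at hu
  have hev : ∀ᶠ y' : energySurface μ M f in 𝓝 y,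
      x.1.1 - qi * x.1.1 * (‖y'.1.1‖⁻¹ • y'.1.1) ≠ 0 :=
    continuous_subtype_val.continuousAt.eventually (eventually_ksLift_ne y.2.2.2.1 hu)
  have hmem (y' : energySurface μ M f) (h : x.1.1 - qi * x.1.1 * (‖y'.1.1‖⁻¹ • y'.1.1) ≠ 0) :
      ksLift x.1.1 y'.1 ∈ regularizedLevel μ M f := by
    rw [← ksMap_mem_iff (ksLift_fst_ne_zero y'.2.2.2.1 h), ksMap_ksLift y'.2.2.2.1 y'.2.1 h]
    exact y'.2
  -- The chosen preimages need not vary continuously, so near `y` they are replaced by the smooth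
  -- lift `ksLift` based at `x`, which lies on the same orbits.
  set s : energySurface μ M f → regularizedLevel μ M f := fun y' =>
    if h : ksLift x.1.1 y'.1 ∈ regularizedLevel μ M f then ⟨_, h⟩ else x with hs
  have hsv : ∀ᶠ y' in 𝓝 y, (s y').1 = ksLift x.1.1 y'.1 := by
    filter_upwards [hev] with y' hy'
    simp only [hs, dif_pos (hmem y' hy')]
  have h1 : ContMDiffAt (𝓡 5) (𝓡 6) ∞ s y := by
    apply hN.contMDiffAt_of_val
    exact ((contDiffAt_ksLift y.2.2.2.1 hu).contMDiffAt.comp y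
      hS.contMDiff_val.contMDiffAt).congr_of_eventuallyEq hsv
  refine ((hC.2.contMDiff (s y)).comp y h1).congr_of_eventuallyEq ?_
  filter_upwards [hev, hsv] with y' h2 h3
  refine (ksInverse_eq_iff y' ?_).2 ?_
  · rw [h3]; exact ksLift_fst_ne_zero y'.2.2.2.1 h2
  · rw [h3]; exact ksMap_ksLift y'.2.2.2.1 y'.2.1 h2

/-- Composed with the projection, `k` is `ksMap` near the chosen preimage, since z ≠ 0 is an open
condition. -/
theorem contMDiffAt_leftInverse (hN : IsSubmanifold 6 (regularizedLevel μ M f))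
    (hS : IsSubmanifold 5 (energySurface μ M f)) (hC : IsQuotientManifold μ M f)
    {k : Compactification μ M f → energySurface μ M f}
    (hk : ∀ y, k (ksInverse μ M f y) = y) (y : energySurface μ M f) :
    ContMDiffAt (𝓡 5) (𝓡 5) ∞ k (ksInverse μ M f y) := by
  refine hC.contMDiffAt_of_comp (x := ksPreimage y) (hS.contMDiffAt_of_val ?_)
  have h1 : ContMDiffAt (𝓡 6) 𝓘(ℝ, ℍ × ℍ) ∞ (fun x : regularizedLevel μ M f => ksMap x.1)
      (ksPreimage y) :=
    (contDiffAt_ksMap (ksPreimage_ne y)).contMDiffAt.comp _ hN.contMDiff_val.contMDiffAt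
  refine h1.congr_of_eventuallyEq ?_
  have h2 : Continuous fun x : regularizedLevel μ M f => x.1.1 :=
    continuous_fst.comp continuous_subtype_val
  filter_upwards [h2.continuousAt.eventually_ne (ksPreimage_ne y)] with x hx
  have h3 := (ksInverse_eq_iff (⟨ksMap x.1, (ksMap_mem_iff hx).2 x.2⟩ : energySurface μ M f)
    hx).2 rfl
  rw [← h3, hk]

theorem isLocalDiffeomorph_ksInverse (hN : IsSubmanifold 6 (regularizedLevel μ M f))
    (hS : IsSubmanifold 5 (energySurface μ M f)) (hC : IsQuotientManifold μ M f) :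
    IsLocalDiffeomorph (𝓡 5) (𝓡 5) ∞ (ksInverse μ M f) := by
  intro y
  have : Nonempty (energySurface μ M f) := ⟨y⟩
  have hk := Function.leftInverse_invFun (ksInverse_injective (μ := μ) (M := M) (f := f))
  refine ⟨⟨⟨ksInverse μ M f, Function.invFun (ksInverse μ M f), univ, range (ksInverse μ M f),
    fun y _ => mem_range_self y, fun _ _ => mem_univ _, fun y _ => hk y, ?_⟩, isOpen_univ,
    isOpen_range_ksInverse, (contMDiff_ksInverse hN hS hC).contMDiffOn, ?_⟩, mem_univ y,
    fun _ _ => rfl⟩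
  · rintro _ ⟨y', rfl⟩
    rw [hk y']
  · rintro _ ⟨y', rfl⟩
    exact (contMDiffAt_leftInverse hN hS hC hk y').contMDiffWithinAt

theorem isCompactification (hμ : 0 < μ) (hM : 0 < M) (hf : 0 < f)
    (hN : IsSubmanifold 6 (regularizedLevel μ M f))
    (hS : IsSubmanifold 5 (energySurface μ M f)) (hC : IsQuotientManifold μ M f) :
    IsCompactification μ M f := by
  have hj := isLocalDiffeomorph_ksInverse hN hS hC
  exact ⟨compactSpace_compactification hμ hM hf, (quotientHomeomorph hμ hM hf).symm.t2Space,
    ksInverse μ M f, .of_continuous_injective_isOpenMap hj.contMDiff.continuous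
      ksInverse_injective hj.isOpenMap, hj, denseRange_ksInverse hμ hM hf, range_ksInverse,
    fun y x hx => ksInverse_eq_iff y hx⟩

end Embedding

end KS

/-! ### Main theorem. -/

theorem mainTheorem6 (μ M f : ℝ) (hμ : 0 < μ) (hM : 0 < M) (hf : 0 < f) :
    (∃ (_ : ChartedSpace (EuclideanSpace ℝ (Fin 6)) (KS.regularizedLevel μ M f))
      (_ : ChartedSpace (EuclideanSpace ℝ (Fin 5)) (KS.energySurface μ M f))
      (_ : ChartedSpace (EuclideanSpace ℝ (Fin 5)) (KS.Compactification μ M f)),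
      KS.IsSubmanifold 6 (KS.regularizedLevel μ M f) ∧
      KS.IsSubmanifold 5 (KS.energySurface μ M f) ∧
      KS.IsQuotientManifold μ M f) ∧
    (∀ (_ : ChartedSpace (EuclideanSpace ℝ (Fin 6)) (KS.regularizedLevel μ M f))
      (_ : ChartedSpace (EuclideanSpace ℝ (Fin 5)) (KS.energySurface μ M f))
      (_ : ChartedSpace (EuclideanSpace ℝ (Fin 5)) (KS.Compactification μ M f)),
      KS.IsSubmanifold 6 (KS.regularizedLevel μ M f) →
      KS.IsSubmanifold 5 (KS.energySurface μ M f) →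
      KS.IsQuotientManifold μ M f →
      KS.IsCompactification μ M f ∧
      Nonempty (KS.Compactification μ M f ≃ₘ⟮𝓡 5, (𝓡 2).prod (𝓡 3)⟯
        (Metric.sphere (0 : EuclideanSpace ℝ (Fin 3)) 1 ×
          Metric.sphere (0 : EuclideanSpace ℝ (Fin 4)) 1))) := by
  refine ⟨?_, ?_⟩
  · let i6 := KS.levelChartedSpace hμ hM hf
    have hN := KS.isSubmanifold_level hμ hM hf
    exact ⟨i6, KS.energyChartedSpace hμ hM hf, KS.quotientChartedSpace hμ hM hf, hN,
      KS.isSubmanifold_energy hμ hM hf, KS.isQuotientManifold_quotient hμ hM hf hN⟩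
  · intro _ _ _ hN hS hC
    exact ⟨KS.isCompactification hμ hM hf hN hS hC, KS.nonempty_diffeomorph hμ hM hf hN hC⟩
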